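/- Let $N\in\{\tfrac12,1,\tfrac32,\dots\}$ and $\nu\in\{0,\tfrac12,1,\dots\}$, and let $[N]$ and $[\nu]$ denote the irreducible unitary $\mathrm{su}(2)$-representations of spin $N$ and $\nu$. Let $X_1,X_2,X_3$ be the Hermitian generators on $[N]$, so that $[X_a,X_b]=i\epsilon_{abc}X_c$ and $\sum_a X_a^2=N(N+1)$ (repeated indices are summed). Put $Y_a=(N(N+1))^{-1/2}X_a$ and $\mathcal A_N=\mathrm{End}([N])$. Let $\mathrm{Der}_3$ be the complex linear span of the derivations $e_a=[X_a,\cdot\,]$ of $\mathcal A_N$. The $p$-forms are the alternating $p$-linear maps from $\mathrm{Der}_3$ to $\mathcal A_N$; moreover $d\phi(u)=u(\phi)$ for $\phi\in\mathcal A_N$, and $(\alpha\wedge\beta)(u,v)=\alpha(u)\beta(v)-\alpha(v)\beta(u)$ for one-forms $\alpha,\beta$. The tensor product representation $[N]\otimes[\nu]$ contains exactly one irreducible subrepresentation $[N+\nu]$ of spin $N+\nu$ and, if $\nu<N$, exactly one irreducible subrepresentation $[N-\nu]$ of spin $N-\nu$. Let $p\in\mathcal A_N\otimes\mathrm{End}([\nu])$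 be the orthogonal projection of $[N]\otimes[\nu]$ onto $[N+\nu]$ or, if $\nu<N$, onto $[N-\nu]$, written as a matrix $p=(p_{ij})$ with entries in $\mathcal A_N$. The first component of the Chern character of the fuzzy line bundle $(\mathcal A_N\otimes[\nu])p$ is the two-form $\mathbf F=\mathrm{Tr}_2(p\,dp\,dp)=\sum_{i,j,k}p_{ij}\,dp_{jk}\wedge dp_{ki}$. Then $$\mathbf F=\frac{iq}{4}\,\epsilon_{abc}\,Y_a\,dY_b\wedge dY_c,\qquad q=\frac4i\,\frac{(N(N+1))^{3/2}}{\tfrac12-N(N+1)}\,f,$$ where $$f=\frac{i\nu(N+1)(N-\nu)(2N-2\nu+1)}{2N(2N+1)(N-\nu+1)^2}$$ if $p$ projects onto $[N-\nu]$ (with $\nu<N$), and $$f=-\frac{iN\nu(N+\nu+1)(N+\nu+\tfrac12)}{(N+\nu)^2(2N+1)(N+1)}$$ if $p$ projects onto $[N+\nu]$. -/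

import Mathlib

/-! Spins are labelled by natural numbers: `n` stands for the spin `N = n / 2`, and `l` for `ν = l / 2`.
The indices `a = 1, 2, 3` are the elements `0, 1, 2` of `Fin 3`. -/

namespace FuzzySphere

open scoped Kronecker
open Complex

/-- The spin `N = n / 2` labelled by the natural number `n`. -/
noncomputable def spin (n : ℕ) : ℝ := n / 2

/-- The Levi-Civita symbol `ε_{abc}`. -/
noncomputable def eps (a b c : Fin 3) : ℂ :=
  (((b : ℕ) : ℂ) - ((a : ℕ) : ℂ)) * (((c : ℕ) : ℂ) - ((a : ℕ) : ℂ)) *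
    (((c : ℕ) : ℂ) - ((b : ℕ) : ℂ)) / 2

/-- The algebra `A_N = End [N]` of the fuzzy sphere, where `[N]` has dimension `2 N + 1 = n + 1`. -/
abbrev A (n : ℕ) : Type := Matrix (Fin (n + 1)) (Fin (n + 1)) ℂ

/-- The raising operator `X₊` of the spin `n / 2` representation in the orthonormal basis
`|0⟩, …, |n⟩` of weight vectors, `|k⟩` having weight `n / 2 - k`:
`X₊ |k⟩ = √(k (n + 1 - k)) |k - 1⟩`. -/
noncomputable def Xplus (n : ℕ) : A n :=
  Matrix.of fun i j =>
    if (i : ℕ) + 1 = (j : ℕ) then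
      ((Real.sqrt (((j : ℕ) : ℝ) * ((n : ℝ) + 1 - ((j : ℕ) : ℝ))) : ℝ) : ℂ)
    else 0

/-- The Hermitian generators `X_1, X_2, X_3` of the irreducible spin `n / 2` representation:
`X_1 = (X₊ + X₋) / 2`, `X_2 = (X₊ - X₋) / (2 i)`, `X_3 = diag (n / 2 - k)`, with `X₋ = X₊ᴴ`. -/
noncomputable def X (n : ℕ) : Fin 3 → A n :=
  ![(1 / 2 : ℂ) • (Xplus n + (Xplus n).conjTranspose),
    (1 / (2 * I) : ℂ) • (Xplus n - (Xplus n).conjTranspose),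
    Matrix.diagonal fun k => (n : ℂ) / 2 - ((k : ℕ) : ℂ)]

/-- `Y_a = (N (N + 1))^{-1/2} X_a`. -/
noncomputable def Y (n : ℕ) (a : Fin 3) : A n :=
  (((spin n * (spin n + 1)) ^ (-(1 / 2) : ℝ) : ℝ) : ℂ) • X n a

/-! ### The derivation-based differential calculus on `A_N` -/

/-- The derivation `e_a (φ) = [X_a, φ]`. -/
noncomputable def e (n : ℕ) (a : Fin 3) : Module.End ℂ (A n) :=
  LinearMap.mulLeft ℂ (X n a) - LinearMap.mulRight ℂ (X n a)

/-- `Der₃ (A_N)`, the linear span of the derivations `e_1, e_2, e_3`. -/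
noncomputable def Der3 (n : ℕ) : Submodule ℂ (Module.End ℂ (A n)) :=
  Submodule.span ℂ (Set.range (e n))

/-- One-forms `A_N ⊗ Der₃*`, as linear maps `Der₃ → A_N`. -/
abbrev OneForm (n : ℕ) : Type := Der3 n →ₗ[ℂ] A n

/-- Two-forms `A_N ⊗ (Der₃* ∧ Der₃*)`, as alternating bilinear maps `Der₃ × Der₃ → A_N`. -/
abbrev TwoForm (n : ℕ) : Type := (Der3 n) [⋀^Fin 2]→ₗ[ℂ] A n

/-- The exterior derivative `A_N → Ω¹`, `dφ (u) = u (φ)`. -/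
noncomputable def d {n : ℕ} (φ : A n) : OneForm n :=
  (LinearMap.applyₗ φ).comp (Der3 n).subtype

/-- The wedge product of one-forms, `(α ∧ β) (u, v) = α (u) β (v) - α (v) β (u)`. -/
noncomputable def wedge {n : ℕ} (α β : OneForm n) : TwoForm n where
  toFun v := α (v 0) * β (v 1) - α (v 1) * β (v 0)
  map_update_add' m i x y := by
    fin_cases i <;> simp [Function.update, add_mul, mul_add] <;> abel
  map_update_smul' m i c x := by
    fin_cases i <;> simp [Function.update, smul_sub]
  map_eq_zero_of_eq' v i j h hij := by
    fin_cases i <;> fin_cases j <;> simp_all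

/-- The left multiplication of a two-form by an element of `A_N`. -/
noncomputable def lmul {n : ℕ} (φ : A n) (ω : TwoForm n) : TwoForm n :=
  (LinearMap.mulLeft ℂ φ).compAlternatingMap ω

/-- `F = Tr (p dp dp) = ∑ p_{ij} dp_{jk} ∧ dp_{ki}`, the first component of the Chern character
determined by the matrix `p = (p_{ij})` with entries in `A_N`. -/
noncomputable def chern {n : ℕ} {ι : Type*} [Fintype ι] (p : Matrix ι ι (A n)) : TwoForm n :=
  ∑ i, ∑ j, ∑ k, lmul (p i j) (wedge (d (p j k)) (d (p k i)))

/-- The two-form `ε_{abc} Y_a dY_b ∧ dY_c` (summed over `a`, `b`, `c`). -/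
noncomputable def epsYdYdY (n : ℕ) : TwoForm n :=
  ∑ a, ∑ b, ∑ c, eps a b c • lmul (Y n a) (wedge (d (Y n b)) (d (Y n c)))

/-! ### The projectors onto `[N ± ν]` in `[N] ⊗ [ν]` -/

/-- The Hilbert space `[N] ⊗ [ν]`, in the product of the orthonormal weight bases. -/
abbrev TensorSpace (n l : ℕ) : Type := EuclideanSpace ℂ (Fin (n + 1) × Fin (l + 1))

/-- The generators `X_a ⊗ 1 + 1 ⊗ X_a` of the representation on `[N] ⊗ [ν]`. -/
noncomputable def J (n l : ℕ) (a : Fin 3) : TensorSpace n l →L[ℂ] TensorSpace n l :=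
  Matrix.toEuclideanCLM (𝕜 := ℂ)
    (X n a ⊗ₖ (1 : A l) + (1 : A n) ⊗ₖ X l a)

/-- `K` is a subrepresentation of `[N] ⊗ [ν]`. -/
def IsSubrep {n l : ℕ} (K : Submodule ℂ (TensorSpace n l)) : Prop :=
  ∀ a, ∀ x ∈ K, J n l a x ∈ K

/-- `K` is an irreducible subrepresentation of `[N] ⊗ [ν]` of spin `m / 2`, that is, of dimension
`m + 1`. -/
structure IsSpinSubrep {n l : ℕ} (m : ℕ) (K : Submodule ℂ (TensorSpace n l)) : Prop where
  invariant : IsSubrep K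
  ne_bot : K ≠ ⊥
  irreducible : ∀ K' : Submodule ℂ (TensorSpace n l), IsSubrep K' → K' ≤ K → K' = ⊥ ∨ K' = K
  finrank_eq : Module.finrank ℂ K = m + 1

/-- The orthogonal projection `p` onto `K ⊆ [N] ⊗ [ν]`, as an element `(p_{ij})` of
`A_N ⊗ End [ν]`, the matrices over `A_N` indexed by the weight basis of `[ν]`. -/
noncomputable def projector {n l : ℕ} (K : Submodule ℂ (TensorSpace n l)) :
    Matrix (Fin (l + 1)) (Fin (l + 1)) (A n) :=
  Matrix.of fun i j => Matrix.of fun r s =>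
    (Matrix.toEuclideanCLM (n := Fin (n + 1) × Fin (l + 1)) (𝕜 := ℂ)).symm
      K.starProjection (r, i) (s, j)

/-! ### The scalars `q` and `f` -/

/-- `q = (4 / i) (N (N + 1))^{3/2} / (1/2 - N (N + 1)) f`. -/
noncomputable def q (N : ℝ) (f : ℂ) : ℂ :=
  4 / I * ((((N * (N + 1)) ^ (3 / 2 : ℝ) / (1 / 2 - N * (N + 1)) : ℝ)) : ℂ) * f

/-- The scalar `f` for the projection onto `[N - ν]`. -/
noncomputable def fMinus (N ν : ℝ) : ℂ :=
  I * ν * (N + 1) * (N - ν) * (2 * N - 2 * ν + 1) / (2 * N * (2 * N + 1) * (N - ν + 1) ^ 2)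

/-- The scalar `f` for the projection onto `[N + ν]`. -/
noncomputable def fPlus (N ν : ℝ) : ℂ :=
  -I * N * ν * ((N + ν + 1) * (N + ν + 1 / 2)) / ((N + ν) ^ 2 * (2 * N + 1) * (N + 1))

end FuzzySphere

namespace FuzzySphere

open Complex Matrix
open scoped Kronecker ComplexOrder

/-! ### Vector operators and the irreducible representations -/

/-! Write p = T Tᴴ, where T is an isometric intertwiner from the spin m/2 representation into [N] ⊗
[ν] and m = n ± l. On two basic derivations, F is the partial trace over [ν] of P [dP, dP], with dP
the commutator of P with X_a ⊗ 1. Since P commutes with the total generators, X_a ⊗ 1 may be traded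
for -Z_a, Z_a = 1 ⊗ X_a, and the curvature becomes [P Z_a P, P Z_b P] - P [Z_a, Z_b] P
(`curvature_eq`).

Everything left is a vector operator, so the Wigner–Eckart theorem
(`IsVectorOperator.exists_eq_smul`) applies twice. The compression Tᴴ Z_a T equals κ X_a on spin
m/2, so the curvature on (e_a, e_{a+1}) is i(κ² - κ) T X_{a+2} Tᴴ. The partial trace of T X_a Tᴴ is
c X_a on [N]. Contracting with generators and using Casimir values determines κ and c
(`exists_compress_right`, `exists_partialTrace_eq`).

The reference form ε Y dY dY is also a multiple of X_{a+2} on (e_a, e_{a+1}) (`epsYdYdY_apply`).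
Hence the two forms are proportional, and the claim reduces to 2f = i(κ² - κ)c.

The intertwiners come from highest weight theory. A unit highest weight vector generates an
isometric copy of the standard representation, and every nonzero invariant subspace contains such a
vector. In [N] ⊗ [ν] a highest weight vector of weight N ± ν is determined by one coordinate, which
yields uniqueness of the subrepresentation. -/

/-- `V` is a vector operator with respect to `M`: `[M_a, V_b] = i ε_{abc} V_c`. -/
structure IsVectorOperator {R : Type*} [Ring R] [Algebra ℂ R] (M V : Fin 3 → R) : Prop where
  comm_self : ∀ a, M a * V a - V a * M a = 0
  comm_add_one : ∀ a, M a * V (a + 1) - V (a + 1) * M a = I • V (a + 2)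
  comm_add_two : ∀ a, M (a + 1) * V a - V a * M (a + 1) = -(I • V (a + 2))

/-- Hermitian matrices satisfying the commutation relations of `su(2)`. -/
structure IsSpinRep {ι : Type*} [Fintype ι] [DecidableEq ι] (M : Fin 3 → Matrix ι ι ℂ) : Prop where
  vector : IsVectorOperator M M
  herm : ∀ a, (M a)ᴴ = M a

/-- Addition in `Fin 3` is cyclic, so the three fields cover all nine index pairs; for V = M the
third is the second with its sign reversed. -/
theorem isVectorOperator_of_comm {R : Type*} [Ring R] [Algebra ℂ R] {M : Fin 3 → R}
    (h : ∀ a, M a * M (a + 1) - M (a + 1) * M a = I • M (a + 2)) : IsVectorOperator M M :=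
  ⟨fun a => sub_self _, h, fun a => by rw [← h, neg_sub]⟩

/-- The matrix element `⟨k| X₊ |k + 1⟩`. -/
noncomputable def ladder (n k : ℕ) : ℝ := Real.sqrt (((k : ℝ) + 1) * ((n : ℝ) - k))

theorem ladder_sq {n k : ℕ} (h : k ≤ n) : ladder n k * ladder n k = ((k : ℝ) + 1) * (n - k) := by
  have : (k : ℝ) ≤ n := by exact_mod_cast h
  exact Real.mul_self_sqrt (mul_nonneg (by positivity) (by linarith))

theorem ladder_sq_complex {n k : ℕ} (h : k ≤ n) :
    (ladder n k : ℂ) * ladder n k = ((k : ℂ) + 1) * (n - k) := by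
  exact_mod_cast congrArg (fun x : ℝ => (x : ℂ)) (ladder_sq h)

theorem ladder_self (n : ℕ) : ladder n n = 0 := by simp [ladder]

theorem ladder_pos {n k : ℕ} (h : k < n) : 0 < ladder n k := by
  have : (k : ℝ) < n := by exact_mod_cast h
  exact Real.sqrt_pos.2 (mul_pos (by positivity) (by linarith))

theorem ladder_ne_zero {n k : ℕ} (h : k < n) : (ladder n k : ℂ) ≠ 0 := by
  exact_mod_cast (ladder_pos h).ne'

theorem Xplus_apply (n : ℕ) (i j : Fin (n + 1)) :
    Xplus n i j = if (i : ℕ) + 1 = j then (ladder n i : ℂ) else 0 := by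
  simp only [Xplus, Matrix.of_apply, ladder]
  split_ifs with h
  · rw [← h]
    push_cast
    congr 3
    ring
  · rfl

theorem X_zero (n : ℕ) : X n 0 = (1 / 2 : ℂ) • (Xplus n + (Xplus n)ᴴ) := rfl

theorem X_one (n : ℕ) : X n 1 = (1 / (2 * I) : ℂ) • (Xplus n - (Xplus n)ᴴ) := rfl

theorem X_two (n : ℕ) : X n 2 = Matrix.diagonal fun k : Fin (n + 1) =>
    (n : ℂ) / 2 - ((k : ℕ) : ℂ) := rfl

theorem X_two_apply_comm {n : ℕ} (V : A n) (i j : Fin (n + 1)) :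
    (X n 2 * V - V * X n 2) i j = ((j : ℕ) - (i : ℕ) : ℂ) * V i j := by
  rw [X_two, Matrix.sub_apply, Matrix.diagonal_mul, Matrix.mul_diagonal]
  ring

theorem X_add_I_smul (n : ℕ) : X n 0 + I • X n 1 = Xplus n := by
  rw [X_zero, X_one, smul_smul]
  have : I * (1 / (2 * I)) = 1 / 2 := by field_simp
  rw [this]
  module

theorem X_sub_I_smul (n : ℕ) : X n 0 - I • X n 1 = (Xplus n)ᴴ := by
  rw [X_zero, X_one, smul_smul]
  have : I * (1 / (2 * I)) = 1 / 2 := by field_simp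
  rw [this]
  module

theorem X_two_comm_Xplus (n : ℕ) : X n 2 * Xplus n - Xplus n * X n 2 = Xplus n := by
  ext i j
  rw [X_two_apply_comm, Xplus_apply]
  split_ifs with h
  · rw [← h]; push_cast; ring
  · simp

theorem X_herm (n : ℕ) (a : Fin 3) : (X n a)ᴴ = X n a := by
  fin_cases a
  · simp [X_zero, add_comm]
  · simp only [Fin.mk_one, X_one, conjTranspose_smul, conjTranspose_sub,
      conjTranspose_conjTranspose]
    rw [← neg_sub (Xplus n), smul_neg, ← neg_smul]
    congr 1
    simp
  · simp only [Fin.reduceFinMk, X_two, diagonal_conjTranspose]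
    congr 1
    ext k
    simp

theorem Xplus_mul_apply_of_lt {n : ℕ} (V : A n) {i : Fin (n + 1)} (j : Fin (n + 1))
    (h : (i : ℕ) + 1 < n + 1) : (Xplus n * V) i j = ladder n i * V ⟨i + 1, h⟩ j := by
  rw [Matrix.mul_apply, Finset.sum_eq_single ⟨i + 1, h⟩]
  · simp [Xplus_apply]
  · intro b _ hb
    rw [Xplus_apply, if_neg, zero_mul]
    exact fun h' => hb (Fin.ext h'.symm)
  · simp

theorem mul_Xplus_apply_succ {n : ℕ} (V : A n) (i : Fin (n + 1)) {j : ℕ}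
    (h : j + 1 < n + 1) :
    (V * Xplus n) i ⟨j + 1, h⟩ = V i ⟨j, by omega⟩ * ladder n j := by
  rw [Matrix.mul_apply, Finset.sum_eq_single ⟨j, by omega⟩]
  · simp [Xplus_apply]
  · intro b _ hb
    rw [Xplus_apply, if_neg, mul_zero]
    exact fun h' => hb (Fin.ext (by simpa using h'))
  · simp

theorem Xplus_mul_conjTranspose (n : ℕ) :
    Xplus n * (Xplus n)ᴴ =
      diagonal fun k : Fin (n + 1) => (((k : ℕ) : ℂ) + 1) * (n - (k : ℕ)) := by
  ext i j
  rw [diagonal_apply]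
  by_cases hi : (i : ℕ) + 1 < n + 1
  · rw [Xplus_mul_apply_of_lt _ _ hi, conjTranspose_apply, Xplus_apply]
    by_cases hij : i = j
    · subst hij
      simp [ladder_sq_complex (show (i : ℕ) ≤ n by omega)]
    · rw [if_neg hij, if_neg (fun h => hij (Fin.ext (by simpa using h.symm)))]
      simp
  · have hin : (i : ℕ) = n := by omega
    have : (Xplus n * (Xplus n)ᴴ) i j = 0 := by
      rw [Matrix.mul_apply]
      exact Finset.sum_eq_zero fun k _ => by rw [Xplus_apply, if_neg (by omega), zero_mul]
    rw [this, hin]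
    simp

theorem conjTranspose_mul_Xplus (n : ℕ) :
    (Xplus n)ᴴ * Xplus n =
      diagonal fun k : Fin (n + 1) => (((k : ℕ) : ℂ)) * (n + 1 - (k : ℕ)) := by
  ext i ⟨j, hj⟩
  rw [diagonal_apply]
  rcases j with _ | j
  · have : ((Xplus n)ᴴ * Xplus n) i ⟨0, hj⟩ = 0 := by
      rw [Matrix.mul_apply]
      exact Finset.sum_eq_zero fun k _ => by rw [Xplus_apply, if_neg (by simp), mul_zero]
    rw [this]
    split_ifs with h
    · simp [h]
    · rfl
  · rw [mul_Xplus_apply_succ, conjTranspose_apply, Xplus_apply]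
    by_cases hij : i = ⟨j + 1, hj⟩
    · subst hij
      simp only [if_true, RCLike.star_def, conj_ofReal,
        ladder_sq_complex (show j ≤ n by omega)]
      push_cast
      ring
    · rw [if_neg hij, if_neg (fun h => hij (Fin.ext (by simpa using h.symm)))]
      simp

theorem Xplus_comm (n : ℕ) :
    Xplus n * (Xplus n)ᴴ - (Xplus n)ᴴ * Xplus n = (2 : ℂ) • X n 2 := by
  rw [Xplus_mul_conjTranspose, conjTranspose_mul_Xplus, X_two]
  ext i j
  simp only [Matrix.sub_apply, Matrix.smul_apply, diagonal_apply, smul_eq_mul]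
  split_ifs <;> ring

theorem X_isSpinRep (n : ℕ) : IsSpinRep (X n) := by
  refine ⟨isVectorOperator_of_comm fun a => ?_, X_herm n⟩
  have h2 := X_two_comm_Xplus n
  have h2' : X n 2 * (Xplus n)ᴴ - (Xplus n)ᴴ * X n 2 = -(Xplus n)ᴴ := by
    have := congrArg conjTranspose h2
    rw [conjTranspose_sub, conjTranspose_mul, conjTranspose_mul, X_herm] at this
    rw [← neg_sub, this]
  have h3 := Xplus_comm n
  set P := Xplus n with hP
  set Q := Pᴴ with hQ
  have hI : (1 / (2 * I) : ℂ) = -(I / 2) := by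
    field_simp
    simp
  fin_cases a
  · simp only [Fin.zero_eta, zero_add, X_zero, X_one, hI, ← hP, ← hQ]
    have : ((1 / 2 : ℂ) • (P + Q)) * (-(I / 2) • (P - Q)) - (-(I / 2) • (P - Q)) *
        ((1 / 2 : ℂ) • (P + Q))
        = (I / 2) • (P * Q - Q * P) := by
      simp only [smul_mul_smul_comm, mul_add, add_mul, mul_sub, sub_mul]
      module
    rw [this, h3, smul_smul]
    congr 1
    ring
  · simp only [Fin.mk_one, Fin.isValue, show (1 : Fin 3) + 1 = 2 from rfl,
      show (1 : Fin 3) + 2 = 0 from rfl, X_zero, X_one, hI, ← hP, ← hQ]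
    have : (-(I / 2) • (P - Q)) * X n 2 - X n 2 * (-(I / 2) • (P - Q)) =
        (I / 2) • ((X n 2 * P - P * X n 2) - (X n 2 * Q - Q * X n 2)) := by
      simp only [smul_mul_assoc, mul_smul_comm, mul_sub, sub_mul]
      module
    rw [this, h2, h2']
    module
  · simp only [Fin.reduceFinMk, Fin.isValue, show (2 : Fin 3) + 1 = 0 from rfl,
      show (2 : Fin 3) + 2 = 1 from rfl, X_zero, X_one, hI, ← hP, ← hQ]
    have : X n 2 * ((1 / 2 : ℂ) • (P + Q)) - ((1 / 2 : ℂ) • (P + Q)) * X n 2 =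
        (1 / 2 : ℂ) • ((X n 2 * P - P * X n 2) + (X n 2 * Q - Q * X n 2)) := by
      simp only [smul_mul_assoc, mul_smul_comm, mul_add, add_mul]
      module
    rw [this, h2, h2', smul_smul]
    have hII : I * -(I / 2) = 1 / 2 := by
      rw [mul_neg, mul_div_assoc', I_mul_I]; norm_num
    rw [hII]
    module

theorem X_casimir (n : ℕ) :
    X n 0 * X n 0 + X n 1 * X n 1 + X n 2 * X n 2 = ((n : ℂ) / 2 * (n / 2 + 1)) • (1 : A n) := by
  have : X n 0 * X n 0 + X n 1 * X n 1 =
      (1 / 2 : ℂ) • (Xplus n * (Xplus n)ᴴ + (Xplus n)ᴴ * Xplus n) := by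
    rw [← X_sub_I_smul, ← X_add_I_smul]
    simp only [mul_add, add_mul, mul_sub, sub_mul, mul_smul_comm, smul_mul_assoc, smul_add,
      smul_sub, smul_smul, I_mul_I]
    module
  rw [this, Xplus_mul_conjTranspose, conjTranspose_mul_Xplus, X_two]
  ext i j
  simp only [Matrix.add_apply, Matrix.smul_apply, diagonal_mul_diagonal, diagonal_apply,
      one_apply, smul_eq_mul]
  split_ifs <;> ring

/-- Schur's lemma for the spin `n / 2` representation. -/
theorem eq_smul_one_of_commute {n : ℕ} {G : A n} (h : ∀ a, X n a * G = G * X n a) :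
    G = G 0 0 • (1 : A n) := by
  -- X₃ is diagonal with simple spectrum, so a matrix commuting with it is diagonal.
  have hd : ∀ i j : Fin (n + 1), i ≠ j → G i j = 0 := by
    intro i j hij
    have := X_two_apply_comm G i j
    rw [h, sub_self, Matrix.zero_apply, eq_comm, mul_eq_zero, sub_eq_zero] at this
    exact this.resolve_left fun h' => hij (Fin.ext (by exact_mod_cast h'.symm))
  have hp : Xplus n * G = G * Xplus n := by
    rw [← X_add_I_smul, add_mul, mul_add, h, smul_mul_assoc, h, mul_smul_comm]
  -- Commutation with X₊ equates neighbouring diagonal entries, because the ladder coefficients do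
  -- not vanish.
  have hk : ∀ k (hk : k < n + 1), G ⟨k, hk⟩ ⟨k, hk⟩ = G 0 0 := by
    intro k
    induction k with
    | zero => intro _; rfl
    | succ k ih =>
      intro hk
      rw [← ih (by omega)]
      have := congrFun (congrFun hp ⟨k, by omega⟩) ⟨k + 1, hk⟩
      rw [Xplus_mul_apply_of_lt _ _ hk, mul_Xplus_apply_succ, mul_comm] at this
      exact mul_right_cancel₀ (ladder_ne_zero (show k < n by omega)) this
  ext i j
  by_cases hij : i = j
  · subst hij
    simp [hk i i.2]
  · simp [hd i j hij, hij]

/-- The Wigner–Eckart theorem for vector operators. -/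
theorem IsVectorOperator.exists_eq_smul {n : ℕ} {V : Fin 3 → A n} (h : IsVectorOperator (X n) V) :
    ∃ c : ℂ, ∀ a, V a = c • X n a := by
  have hX := (X_isSpinRep n).vector
  -- V₊ raises the weight by one and commutes with X₊. It therefore lives on the superdiagonal,
  -- where a recursion makes it proportional to X₊; the components of V are then recovered by
  -- commutators.
  set Vp := V 0 + I • V 1 with hVp
  have c00 := h.comm_self 0
  have c11 := h.comm_self 1
  have c01 : X n 0 * V 1 - V 1 * X n 0 = I • V 2 := h.comm_add_one 0
  have c12 : X n 1 * V 2 - V 2 * X n 1 = I • V 0 := h.comm_add_one 1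
  have c20 : X n 2 * V 0 - V 0 * X n 2 = I • V 1 := h.comm_add_one 2
  have c10 : X n 1 * V 0 - V 0 * X n 1 = -(I • V 2) := h.comm_add_two 0
  have c21 : X n 2 * V 1 - V 1 * X n 2 = -(I • V 0) := h.comm_add_two 1
  have hw : X n 2 * Vp - Vp * X n 2 = Vp := by
    have : X n 2 * Vp - Vp * X n 2 =
        (X n 2 * V 0 - V 0 * X n 2) + I • (X n 2 * V 1 - V 1 * X n 2) := by
      simp only [hVp, mul_add, add_mul, mul_smul_comm, smul_mul_assoc]
      module
    rw [this, c20, c21, smul_neg, smul_smul, I_mul_I, hVp]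
    module
  have hp : Xplus n * Vp = Vp * Xplus n := by
    rw [← sub_eq_zero, ← X_add_I_smul]
    have : (X n 0 + I • X n 1) * Vp - Vp * (X n 0 + I • X n 1) =
        (X n 0 * V 0 - V 0 * X n 0) + I • (X n 0 * V 1 - V 1 * X n 0) +
        I • (X n 1 * V 0 - V 0 * X n 1) + (I * I) • (X n 1 * V 1 - V 1 * X n 1) := by
      simp only [hVp, mul_add, add_mul, mul_smul_comm, smul_mul_assoc]
      module
    rw [this, c00, c11, c01, c10]
    simp
  have hd : ∀ i j : Fin (n + 1), (i : ℕ) + 1 ≠ j → Vp i j = 0 := by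
    intro i j hij
    have := X_two_apply_comm Vp i j
    rw [hw, eq_comm, ← sub_eq_zero, ← sub_one_mul, mul_eq_zero, sub_eq_zero,
        sub_eq_iff_eq_add] at this
    refine this.resolve_left fun h' => hij ?_
    rw [add_comm]
    exact_mod_cast h'.symm
  have hm : ∃ c : ℂ, Vp = c • Xplus n := by
    rcases Nat.eq_zero_or_pos n with rfl | hn
    · refine ⟨0, ?_⟩
      ext i j
      rw [hd i j (by omega)]
      simp
    · set c : ℂ := Vp ⟨0, by omega⟩ ⟨1, by omega⟩ / ladder n 0 with hc
      have hk : ∀ k (hk : k + 1 < n + 1), Vp ⟨k, by omega⟩ ⟨k + 1, hk⟩ = c * ladder n k := by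
        intro k
        induction k with
        | zero =>
          intro _
          rw [hc, div_mul_cancel₀ _ (ladder_ne_zero hn)]
        | succ k ih =>
          intro hk
          have := congrFun (congrFun hp ⟨k, by omega⟩) ⟨k + 1 + 1, hk⟩
          rw [Xplus_mul_apply_of_lt _ _ (by simp; omega), mul_Xplus_apply_succ,
              ih (by omega)] at this
          apply mul_left_cancel₀ (ladder_ne_zero (show k < n by omega))
          rw [this]
          ring
      refine ⟨c, ?_⟩
      ext i ⟨j, hj⟩
      rw [Matrix.smul_apply, Xplus_apply]
      split_ifs with hij
      · simp only at hij
        subst hij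
        exact hk i hj
      · rw [hd i _ hij, smul_zero]
  obtain ⟨c, hc⟩ := hm
  have h2 : V 2 = c • X n 2 := by
    -- The third component is -[X₋, W₊]/2 for every vector operator; comparing W = V with W = X
    -- carries over the same constant.
    have e : ∀ W : Fin 3 → A n, IsVectorOperator (X n) W →
        W 2 = -(1 / 2 : ℂ) • ((Xplus n)ᴴ * (W 0 + I • W 1) - (W 0 + I • W 1) * (Xplus n)ᴴ) := by
      intro W hW
      have d01 : X n 0 * W 1 - W 1 * X n 0 = I • W 2 := hW.comm_add_one 0
      have d10 : X n 1 * W 0 - W 0 * X n 1 = -(I • W 2) := hW.comm_add_two 0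
      have : (X n 0 - I • X n 1) * (W 0 + I • W 1) - (W 0 + I • W 1) * (X n 0 - I • X n 1) =
        (X n 0 * W 0 - W 0 * X n 0) + I • (X n 0 * W 1 - W 1 * X n 0) -
        I • (X n 1 * W 0 - W 0 * X n 1) - (I * I) • (X n 1 * W 1 - W 1 * X n 1) := by
        simp only [mul_add, add_mul, mul_sub, sub_mul, mul_smul_comm, smul_mul_assoc]
        module
      rw [← X_sub_I_smul, this, hW.comm_self, hW.comm_self, d01, d10, smul_neg, smul_smul, I_mul_I]
      module
    rw [e V h, ← hVp, hc, e _ hX, X_add_I_smul, mul_smul_comm, smul_mul_assoc, ← smul_sub,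
        smul_comm]
  have h0 : V 0 = c • X n 0 := by
    have e : X n 1 * X n 2 - X n 2 * X n 1 = I • X n 0 := hX.comm_add_one 1
    apply smul_right_injective _ I_ne_zero
    simp only
    rw [← c12, h2, mul_smul_comm, smul_mul_assoc, ← smul_sub, e, smul_comm]
  have h1 : V 1 = c • X n 1 := by
    have e : X n 2 * X n 0 - X n 0 * X n 2 = I • X n 1 := hX.comm_add_one 2
    apply smul_right_injective _ I_ne_zero
    simp only
    rw [← c20, h0, mul_smul_comm, smul_mul_assoc, ← smul_sub, e, smul_comm]
  refine ⟨c, fun a => ?_⟩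
  fin_cases a
  exacts [h0, h1, h2]

/-! ### Highest weight vectors and the representations they generate -/

section HighestWeight

set_option linter.unusedSectionVars false

variable {ι : Type*} [Fintype ι] [DecidableEq ι]

/-- `M₊ = M_1 + i M_2`. -/
noncomputable def raising (M : Fin 3 → Matrix ι ι ℂ) : Matrix ι ι ℂ := M 0 + I • M 1

/-- `M₋ = M_1 - i M_2`. -/
noncomputable def lowering (M : Fin 3 → Matrix ι ι ℂ) : Matrix ι ι ℂ := M 0 - I • M 1

theorem eq_half_raising_add_lowering (M : Fin 3 → Matrix ι ι ℂ) :
    M 0 = (1 / 2 : ℂ) • (raising M + lowering M) := by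
  simp only [raising, lowering]
  module

theorem eq_half_raising_sub_lowering (M : Fin 3 → Matrix ι ι ℂ) :
    M 1 = (-(I / 2) : ℂ) • (raising M - lowering M) := by
  simp only [raising, lowering, add_sub_sub_cancel, ← two_smul ℂ (I • M 1), smul_smul]
  have : -(I / 2) * (2 * I) = 1 := by
    ring_nf
    simp
  rw [this, one_smul]

variable {M : Fin 3 → Matrix ι ι ℂ}

theorem IsSpinRep.raising_conjTranspose (hM : IsSpinRep M) : (raising M)ᴴ = lowering M := by
  simp [raising, lowering, hM.herm, sub_eq_add_neg]

theorem IsSpinRep.comm_raising (hM : IsSpinRep M) :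
    M 2 * raising M - raising M * M 2 = raising M := by
  have c20 : M 2 * M 0 - M 0 * M 2 = I • M 1 := hM.vector.comm_add_one 2
  have c21 : M 2 * M 1 - M 1 * M 2 = -(I • M 0) := hM.vector.comm_add_two 1
  have : M 2 * raising M - raising M * M 2 =
      (M 2 * M 0 - M 0 * M 2) + I • (M 2 * M 1 - M 1 * M 2) := by
    simp only [raising, mul_add, add_mul, mul_smul_comm, smul_mul_assoc]
    module
  rw [this, c20, c21, smul_neg, smul_smul, I_mul_I, raising]
  module

theorem IsSpinRep.comm_lowering (hM : IsSpinRep M) :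
    M 2 * lowering M - lowering M * M 2 = -lowering M := by
  have := congrArg conjTranspose hM.comm_raising
  rw [conjTranspose_sub, conjTranspose_mul, conjTranspose_mul, hM.herm,
    hM.raising_conjTranspose] at this
  rw [← neg_sub, this]

theorem IsSpinRep.raising_comm_lowering (hM : IsSpinRep M) :
    raising M * lowering M - lowering M * raising M = (2 : ℂ) • M 2 := by
  have c01 : M 0 * M 1 - M 1 * M 0 = I • M 2 := hM.vector.comm_add_one 0
  have : raising M * lowering M - lowering M * raising M = (-(2 * I)) • (M 0 * M 1 - M 1 *
      M 0) := by
    simp only [raising, lowering, mul_add, add_mul, mul_sub, sub_mul, mul_smul_comm,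
      smul_mul_assoc]
    module
  rw [this, c01, smul_smul]
  congr 1
  ring_nf
  simp

/-- `u` has weight `m / 2` and is annihilated by `M₊`. -/
structure IsHighestWeight (M : Fin 3 → Matrix ι ι ℂ) (m : ℕ) (u : ι → ℂ) : Prop where
  raise : raising M *ᵥ u = 0
  weight : M 2 *ᵥ u = ((m : ℂ) / 2) • u

theorem IsHighestWeight.smul {m : ℕ} {u : ι → ℂ} (h : IsHighestWeight M m u) (c : ℂ) :
    IsHighestWeight M m (c • u) :=
  ⟨by rw [mulVec_smul, h.raise, smul_zero], by rw [mulVec_smul, h.weight, smul_comm]⟩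

theorem IsHighestWeight.sub {m : ℕ} {u v : ι → ℂ} (h : IsHighestWeight M m u)
    (h' : IsHighestWeight M m v) : IsHighestWeight M m (u - v) :=
  ⟨by rw [mulVec_sub, h.raise, h'.raise, sub_zero],
    by rw [mulVec_sub, h.weight, h'.weight, smul_sub]⟩

/-- The weight vectors obtained from `u` by the normalized action of `M₋`. -/
noncomputable def weightVector (M : Fin 3 → Matrix ι ι ℂ) (m : ℕ) (u : ι → ℂ) : ℕ → ι → ℂ
  | 0 => u
  | k + 1 => ((ladder m k : ℂ)⁻¹) • (lowering M *ᵥ weightVector M m u k)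

/-- The matrix whose columns are the weight vectors generated by `u`. -/
noncomputable def intertwiner (M : Fin 3 → Matrix ι ι ℂ) (m : ℕ) (u : ι → ℂ) :
    Matrix ι (Fin (m + 1)) ℂ :=
  Matrix.of fun i k => weightVector M m u k i

theorem lowering_mulVec_weightVector {m k : ℕ} (u : ι → ℂ) (hk : k < m) :
    lowering M *ᵥ weightVector M m u k = (ladder m k : ℂ) • weightVector M m u (k + 1) := by
  rw [weightVector, smul_inv_smul₀ (ladder_ne_zero hk)]

theorem IsHighestWeight.weight_weightVector {m : ℕ} {u : ι → ℂ} (hM : IsSpinRep M)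
    (h : IsHighestWeight M m u) (k : ℕ) :
    M 2 *ᵥ weightVector M m u k = ((m : ℂ) / 2 - k) • weightVector M m u k := by
  induction k with
  | zero => simpa [weightVector] using h.weight
  | succ k ih =>
    have : M 2 * lowering M = lowering M * M 2 - lowering M := by
      rw [sub_eq_add_neg, ← hM.comm_lowering]
      abel
    rw [weightVector, mulVec_smul, mulVec_mulVec, this, sub_mulVec, ← mulVec_mulVec, ih,
      mulVec_smul]
    push_cast
    module

/-- Induction through M₊M₋ = M₋M₊ + 2M₃: the coefficients satisfy k(m + 1 - k) + (m - 2k) = (k +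
1)(m - k). -/
theorem IsHighestWeight.raise_lower_weightVector {m : ℕ} {u : ι → ℂ} (hM : IsSpinRep M)
    (h : IsHighestWeight M m u) {k : ℕ} (hk : k ≤ m) :
    raising M *ᵥ lowering M *ᵥ weightVector M m u k =
      (((k : ℂ) + 1) * (m - k)) • weightVector M m u k := by
  have hc : raising M * lowering M = lowering M * raising M + (2 : ℂ) • M 2 := by
    rw [← hM.raising_comm_lowering]
    abel
  rw [mulVec_mulVec, hc, add_mulVec, ← mulVec_mulVec, smul_mulVec, h.weight_weightVector hM]
  induction k with
  | zero =>
    rw [weightVector, h.raise, mulVec_zero, zero_add, smul_smul]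
    congr 1
    push_cast
    ring
  | succ k ih =>
    have hr : raising M *ᵥ weightVector M m u (k + 1) =
        (ladder m k : ℂ) • weightVector M m u k := by
      rw [weightVector, mulVec_smul, mulVec_mulVec, hc, add_mulVec, ← mulVec_mulVec, smul_mulVec,
        h.weight_weightVector hM, ih (by omega), ← ladder_sq_complex (by omega), smul_smul,
        inv_mul_cancel_left₀ (ladder_ne_zero (by omega))]
    rw [hr, mulVec_smul, lowering_mulVec_weightVector u (by omega), smul_smul, smul_smul,
      ladder_sq_complex (by omega), ← add_smul]
    congr 1
    push_cast
    ring

theorem IsHighestWeight.raising_mulVec_weightVector {m : ℕ} {u : ι → ℂ} (hM : IsSpinRep M)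
    (h : IsHighestWeight M m u) {k : ℕ} (hk : k < m) :
    raising M *ᵥ weightVector M m u (k + 1) = (ladder m k : ℂ) • weightVector M m u k := by
  rw [weightVector, mulVec_smul, h.raise_lower_weightVector hM hk.le, ← ladder_sq_complex hk.le,
    smul_smul, inv_mul_cancel_left₀ (ladder_ne_zero hk)]

/-- By hermiticity the squared norm of M₋w is ⟨w, M₊M₋w⟩, which vanishes at k = m. This is what
closes the chain of weight vectors after m + 1 steps. -/
theorem IsHighestWeight.lowering_mulVec_last {m : ℕ} {u : ι → ℂ} (hM : IsSpinRep M)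
    (h : IsHighestWeight M m u) : lowering M *ᵥ weightVector M m u m = 0 := by
  rw [← dotProduct_star_self_eq_zero, star_mulVec, ← dotProduct_mulVec,
    ← hM.raising_conjTranspose, conjTranspose_conjTranspose, hM.raising_conjTranspose,
    h.raise_lower_weightVector hM le_rfl]
  simp

theorem mul_intertwiner_apply (B : Matrix ι ι ℂ) (m : ℕ) (u : ι → ℂ) (i : ι) (k : Fin (m + 1)) :
    (B * intertwiner M m u) i k = (B *ᵥ weightVector M m u k) i := rfl

theorem IsHighestWeight.mul_intertwiner {m : ℕ} {u : ι → ℂ} (hM : IsSpinRep M)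
    (h : IsHighestWeight M m u) (a : Fin 3) :
    M a * intertwiner M m u = intertwiner M m u * X m a := by
  set T := intertwiner M m u with hT
  have h2 : M 2 * T = T * X m 2 := by
    ext i k
    rw [mul_intertwiner_apply, h.weight_weightVector hM, X_two, mul_diagonal, mul_comm]
    rfl
  have hp : raising M * T = T * Xplus m := by
    ext i ⟨k, hk⟩
    rw [mul_intertwiner_apply]
    rcases k with _ | k
    · rw [weightVector, h.raise, Matrix.mul_apply]
      exact (Finset.sum_eq_zero fun j _ => by rw [Xplus_apply, if_neg (by simp), mul_zero]).symm
    · rw [h.raising_mulVec_weightVector hM (by omega), Matrix.mul_apply,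
        Finset.sum_eq_single ⟨k, by omega⟩]
      · simp [Xplus_apply, hT, intertwiner, mul_comm]
      · intro b _ hb
        rw [Xplus_apply, if_neg, mul_zero]
        exact fun h' => hb (Fin.ext (by simpa using h'))
      · simp
  have hl : lowering M * T = T * (Xplus m)ᴴ := by
    ext i ⟨k, hk⟩
    rw [mul_intertwiner_apply]
    rcases Nat.lt_succ_iff_lt_or_eq.1 hk with hk' | rfl
    · rw [lowering_mulVec_weightVector u hk', Matrix.mul_apply,
        Finset.sum_eq_single ⟨k + 1, by omega⟩]
      · simp [Xplus_apply, hT, intertwiner, mul_comm]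
      · intro b _ hb
        rw [conjTranspose_apply, Xplus_apply, if_neg, star_zero, mul_zero]
        exact fun h' => hb (Fin.ext h'.symm)
      · simp
    · rw [h.lowering_mulVec_last hM, Matrix.mul_apply]
      refine (Finset.sum_eq_zero fun j _ => ?_).symm
      rw [conjTranspose_apply, Xplus_apply, if_neg (by simp; omega), star_zero, mul_zero]
  fin_cases a
  · simp only [Fin.zero_eta]
    rw [eq_half_raising_add_lowering M, Matrix.smul_mul, Matrix.add_mul, hp, hl, X_zero,
      Matrix.mul_smul, Matrix.mul_add]
  · simp only [Fin.mk_one]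
    rw [eq_half_raising_sub_lowering M, Matrix.smul_mul, Matrix.sub_mul, hp, hl, X_one,
      Matrix.mul_smul, Matrix.mul_sub]
    congr 1
    field_simp
    simp
  · exact h2

/-- TᴴT commutes with the irreducible generators, so it is scalar by Schur's lemma, and its (0, 0)
entry is the squared norm of u. No norm of a lowered vector has to be computed. -/
theorem IsHighestWeight.conjTranspose_mul_intertwiner {m : ℕ} {u : ι → ℂ} (hM : IsSpinRep M)
    (h : IsHighestWeight M m u) (hu : star u ⬝ᵥ u = 1) :
    (intertwiner M m u)ᴴ * intertwiner M m u = 1 := by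
  rw [eq_smul_one_of_commute (G := (intertwiner M m u)ᴴ * intertwiner M m u)]
  · have : ((intertwiner M m u)ᴴ * intertwiner M m u) 0 0 = 1 := by rw [← hu]; rfl
    rw [this, one_smul]
  · intro a
    rw [Matrix.mul_assoc, ← h.mul_intertwiner hM, ← Matrix.mul_assoc, ← Matrix.mul_assoc]
    congr 1
    have := congrArg conjTranspose (h.mul_intertwiner hM a)
    rwa [conjTranspose_mul, conjTranspose_mul, hM.herm, X_herm, eq_comm] at this

/-- `K` is invariant under the matrices `M_a`. -/
def IsInvariant (M : Fin 3 → Matrix ι ι ℂ) (K : Submodule ℂ (ι → ℂ)) : Prop :=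
  ∀ a, ∀ x ∈ K, M a *ᵥ x ∈ K

theorem IsInvariant.raising_mem {K : Submodule ℂ (ι → ℂ)} (hK : IsInvariant M K) {x : ι → ℂ}
    (hx : x ∈ K) : raising M *ᵥ x ∈ K := by
  rw [raising, add_mulVec, smul_mulVec]
  exact K.add_mem (hK 0 x hx) (K.smul_mem _ (hK 1 x hx))

theorem IsInvariant.lowering_mem {K : Submodule ℂ (ι → ℂ)} (hK : IsInvariant M K) {x : ι → ℂ}
    (hx : x ∈ K) : lowering M *ᵥ x ∈ K := by
  rw [lowering, sub_mulVec, smul_mulVec]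
  exact K.sub_mem (hK 0 x hx) (K.smul_mem _ (hK 1 x hx))

theorem IsInvariant.range_intertwiner_le {K : Submodule ℂ (ι → ℂ)} (hK : IsInvariant M K)
    {u : ι → ℂ} (hu : u ∈ K) (m : ℕ) :
    LinearMap.range (intertwiner M m u).mulVecLin ≤ K := by
  have hw : ∀ k, weightVector M m u k ∈ K := by
    intro k
    induction k with
    | zero => exact hu
    | succ k ih => exact K.smul_mem _ (hK.lowering_mem ih)
  rw [range_mulVecLin, Submodule.span_le]
  rintro _ ⟨k, rfl⟩
  exact hw k

theorem self_mem_range_intertwiner (m : ℕ) (u : ι → ℂ) :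
    u ∈ LinearMap.range (intertwiner M m u).mulVecLin := by
  rw [range_mulVecLin]
  exact Submodule.subset_span ⟨0, rfl⟩

theorem IsHighestWeight.isInvariant_range {m : ℕ} {u : ι → ℂ} (hM : IsSpinRep M)
    (h : IsHighestWeight M m u) :
    IsInvariant M (LinearMap.range (intertwiner M m u).mulVecLin) := by
  rintro a _ ⟨x, rfl⟩
  refine ⟨X m a *ᵥ x, ?_⟩
  simp only [mulVecLin_apply, mulVec_mulVec, h.mul_intertwiner hM]

theorem IsHighestWeight.injective {m : ℕ} {u : ι → ℂ} (hM : IsSpinRep M)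
    (h : IsHighestWeight M m u) (hu : star u ⬝ᵥ u = 1) :
    Function.Injective (intertwiner M m u).mulVecLin := by
  intro x y hxy
  have := congrArg ((intertwiner M m u)ᴴ *ᵥ ·) hxy
  simpa [h.conjTranspose_mul_intertwiner hM hu] using this

theorem IsHighestWeight.finrank_range {m : ℕ} {u : ι → ℂ} (hM : IsSpinRep M)
    (h : IsHighestWeight M m u) (hu : star u ⬝ᵥ u = 1) :
    Module.finrank ℂ (LinearMap.range (intertwiner M m u).mulVecLin) = m + 1 := by
  rw [LinearMap.finrank_range_of_inj (h.injective hM hu)]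
  simp

/-! ### Existence of highest weight vectors and irreducibility -/

theorem exists_normalized {u : ι → ℂ} (hu : u ≠ 0) : ∃ c : ℂ, star (c • u) ⬝ᵥ (c • u) = 1 := by
  have h0 : WithLp.toLp 2 u ≠ (0 : EuclideanSpace ℂ ι) := by simpa using hu
  refine ⟨(‖(WithLp.toLp 2 u : EuclideanSpace ℂ ι)‖ : ℂ)⁻¹, ?_⟩
  have h1 : star u ⬝ᵥ u = (‖(WithLp.toLp 2 u : EuclideanSpace ℂ ι)‖ : ℂ) ^ 2 := by
    have := inner_self_eq_norm_sq_to_K (𝕜 := ℂ) (WithLp.toLp 2 u : EuclideanSpace ℂ ι)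
    rw [EuclideanSpace.inner_eq_star_dotProduct, dotProduct_comm] at this
    exact this
  have h2 : (‖(WithLp.toLp 2 u : EuclideanSpace ℂ ι)‖ : ℂ) ≠ 0 := by simpa using h0
  rw [star_smul, smul_dotProduct, dotProduct_smul, h1]
  simp only [star_inv₀, RCLike.star_def, conj_ofReal, smul_eq_mul]
  field_simp

-- Integrality comes from the theory of primitive vectors for the sl₂-triple (2M₃, M₊, M₋). The case
-- M₃ = 0 is separate because the element h of a triple must be nonzero.
attribute [local instance] LieRing.ofAssociativeRing in
theorem exists_weight_eq_nat (hM : IsSpinRep M) {u : ι → ℂ} (hu : u ≠ 0)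
    (hr : raising M *ᵥ u = 0) {μ : ℂ} (hw : M 2 *ᵥ u = μ • u) : ∃ m : ℕ, μ = m / 2 := by
  by_cases h0 : M 2 = 0
  · refine ⟨0, ?_⟩
    rw [h0, zero_mulVec, eq_comm, smul_eq_zero] at hw
    simpa using hw.resolve_right hu
  let lin : Matrix ι ι ℂ → Module.End ℂ (ι → ℂ) := fun A => toLin' A
  have hlie : ∀ A B, ⁅lin A, lin B⁆ = lin (A * B - B * A) := fun A B => by
    simp only [lin, Ring.lie_def, map_sub, toLin'_mul]
    rfl
  have ht : IsSl2Triple (lin ((2 : ℂ) • M 2)) (lin (raising M)) (lin (lowering M)) := by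
    refine ⟨?_, ?_, ?_, ?_⟩
    · simpa [lin] using h0
    · rw [hlie, hM.raising_comm_lowering]
    · rw [hlie, smul_mul_assoc, mul_smul_comm, ← smul_sub, hM.comm_raising]
      simp [lin, two_smul]
    · rw [hlie, smul_mul_assoc, mul_smul_comm, ← smul_sub, hM.comm_lowering]
      simp [lin, two_smul]
  have hp : ht.HasPrimitiveVectorWith u (2 * μ) :=
    ⟨hu, by
      change toLin' ((2 : ℂ) • M 2) u = _
      rw [toLin'_apply, smul_mulVec, hw, smul_smul], by
      change toLin' (raising M) u = _
      rw [toLin'_apply, hr]⟩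
  obtain ⟨m, hm⟩ : ∃ m : ℕ, 2 * μ = m := hp.exists_nat
  exact ⟨m, by rw [← hm]; ring⟩

/-- Take an eigenvector of M₃ on K whose eigenvalue has maximal real part: were M₊ not to kill it, μ
+ 1 would be an eigenvalue too. -/
theorem IsInvariant.exists_isHighestWeight (hM : IsSpinRep M) {K : Submodule ℂ (ι → ℂ)}
    (hK : IsInvariant M K) (h0 : K ≠ ⊥) :
    ∃ m : ℕ, ∃ u ∈ K, star u ⬝ᵥ u = 1 ∧ IsHighestWeight M m u := by
  have : Nontrivial K := Submodule.nontrivial_iff_ne_bot.2 h0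
  let f : Module.End ℂ K := (M 2).mulVecLin.restrict (hK 2)
  obtain ⟨μ, hμ, hmax⟩ := Set.exists_max_image {μ | f.HasEigenvalue μ} Complex.re
    f.finite_hasEigenvalue (Module.End.exists_eigenvalue f)
  obtain ⟨v, hv⟩ := hμ.exists_hasEigenvector
  have hv0 : (v : ι → ℂ) ≠ 0 := by simpa using hv.2
  have hw : M 2 *ᵥ (v : ι → ℂ) = μ • (v : ι → ℂ) := congrArg Subtype.val hv.apply_eq_smul
  have hr : raising M *ᵥ (v : ι → ℂ) = 0 := by
    by_contra hne
    have hc : M 2 * raising M = raising M * M 2 + raising M := by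
      rw [← sub_eq_iff_eq_add', hM.comm_raising]
    have hev : f.HasEigenvector (μ + 1) ⟨raising M *ᵥ (v : ι → ℂ), hK.raising_mem v.2⟩ := by
      refine ⟨Module.End.mem_eigenspace_iff.2 (Subtype.ext ?_), fun h =>
          hne (congrArg Subtype.val h)⟩
      change M 2 *ᵥ raising M *ᵥ (v : ι → ℂ) = (μ + 1) • (raising M *ᵥ (v : ι → ℂ))
      rw [mulVec_mulVec, hc, add_mulVec, ← mulVec_mulVec, hw, mulVec_smul, add_smul, one_smul]
    have := hmax (μ + 1) (Module.End.hasEigenvalue_of_hasEigenvector hev)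
    simp at this
    linarith
  obtain ⟨m, rfl⟩ := exists_weight_eq_nat hM hv0 hr hw
  obtain ⟨c, hc⟩ := exists_normalized hv0
  exact ⟨m, c • v, K.smul_mem c v.2, hc, IsHighestWeight.smul ⟨hr, hw⟩ c⟩

/-- K contains a highest weight vector Tx. Then X₊x = 0, which leaves only the top coordinate of x,
so Tx is a nonzero multiple of u and u lies in K. -/
theorem IsHighestWeight.irreducible {m : ℕ} {u : ι → ℂ} (hM : IsSpinRep M)
    (h : IsHighestWeight M m u) (hu : star u ⬝ᵥ u = 1) {K : Submodule ℂ (ι → ℂ)}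
    (hK : IsInvariant M K) (h0 : K ≠ ⊥)
    (hle : K ≤ LinearMap.range (intertwiner M m u).mulVecLin) :
    K = LinearMap.range (intertwiner M m u).mulVecLin := by
  refine le_antisymm hle (hK.range_intertwiner_le ?_ m)
  obtain ⟨m', v, hvK, hv1, hv⟩ := hK.exists_isHighestWeight hM h0
  obtain ⟨x, hx⟩ := hle hvK
  have hp : raising M * intertwiner M m u = intertwiner M m u * Xplus m := by
    rw [raising, Matrix.add_mul, Matrix.smul_mul, h.mul_intertwiner hM, h.mul_intertwiner hM,
      ← Matrix.mul_smul, ← Matrix.mul_add, X_add_I_smul]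
  have hX : Xplus m *ᵥ x = 0 := by
    apply h.injective hM hu
    rw [map_zero, mulVecLin_apply, mulVec_mulVec, ← hp, ← mulVec_mulVec,
        ← mulVecLin_apply (intertwiner M m u), hx,
      hv.raise]
  have hx0 : ∀ k : Fin (m + 1), k ≠ 0 → x k = 0 := by
    rintro ⟨k, hk⟩ hk0
    obtain ⟨k, rfl⟩ := Nat.exists_eq_succ_of_ne_zero (fun h' => hk0 (Fin.ext h'))
    have := congrFun hX ⟨k, by omega⟩
    rw [mulVec, dotProduct, Finset.sum_eq_single ⟨k + 1, hk⟩] at this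
    · simpa [Xplus_apply, ladder_ne_zero (show k < m by omega)] using this
    · intro b _ hb
      rw [Xplus_apply, if_neg, zero_mul]
      exact fun h' => hb (Fin.ext h'.symm)
    · simp
  have hvu : v = x 0 • u := by
    rw [← hx]
    ext i
    rw [mulVecLin_apply, mulVec, dotProduct, Finset.sum_eq_single 0]
    · simp [intertwiner, weightVector, mul_comm]
    · intro b _ hb
      rw [hx0 b hb, mul_zero]
    · simp
  have hx0 : x 0 ≠ 0 := by
    intro h'
    rw [hvu, h'] at hv1
    simp at hv1
  rw [hvu] at hvK
  exact (Submodule.smul_mem_iff K hx0).1 hvK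

end HighestWeight

/-! ### The tensor product `[N] ⊗ [ν]` -/

/-- The generators of `[N] ⊗ [ν]` as matrices. -/
noncomputable def tensorGen (n l : ℕ) (a : Fin 3) :
    Matrix (Fin (n + 1) × Fin (l + 1)) (Fin (n + 1) × Fin (l + 1)) ℂ :=
  X n a ⊗ₖ (1 : A l) + (1 : A n) ⊗ₖ X l a

theorem kronecker_one_commute (n l : ℕ) (B : A n) (C : A l) :
    (B ⊗ₖ (1 : A l)) * ((1 : A n) ⊗ₖ C) = ((1 : A n) ⊗ₖ C) * (B ⊗ₖ (1 : A l)) := by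
  rw [← mul_kronecker_mul, ← mul_kronecker_mul]
  simp

theorem kronecker_one_comm (n l : ℕ) (B C : A n) :
    (B ⊗ₖ (1 : A l)) * (C ⊗ₖ (1 : A l)) - (C ⊗ₖ (1 : A l)) * (B ⊗ₖ (1 : A l)) =
      (B * C - C * B) ⊗ₖ (1 : A l) := by
  rw [← mul_kronecker_mul, ← mul_kronecker_mul, Matrix.mul_one, sub_eq_add_neg, ← neg_one_smul ℂ,
    ← smul_kronecker, ← add_kronecker, neg_one_smul, ← sub_eq_add_neg]

theorem one_kronecker_comm (n l : ℕ) (B C : A l) :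
    ((1 : A n) ⊗ₖ B) * ((1 : A n) ⊗ₖ C) - ((1 : A n) ⊗ₖ C) * ((1 : A n) ⊗ₖ B) =
      (1 : A n) ⊗ₖ (B * C - C * B) := by
  rw [← mul_kronecker_mul, ← mul_kronecker_mul, Matrix.mul_one, sub_eq_add_neg, ← neg_one_smul ℂ,
    ← kronecker_smul, ← kronecker_add, neg_one_smul, ← sub_eq_add_neg]

theorem right_isVectorOperator (n l : ℕ) :
    IsVectorOperator (fun a => (1 : A n) ⊗ₖ X l a) (fun a => (1 : A n) ⊗ₖ X l a) := by
  refine isVectorOperator_of_comm fun a => ?_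
  rw [one_kronecker_comm, (X_isSpinRep l).vector.comm_add_one, kronecker_smul]

theorem left_isVectorOperator (n l : ℕ) :
    IsVectorOperator (fun a => X n a ⊗ₖ (1 : A l)) (fun a => X n a ⊗ₖ (1 : A l)) := by
  refine isVectorOperator_of_comm fun a => ?_
  rw [kronecker_one_comm, (X_isSpinRep n).vector.comm_add_one, smul_kronecker]

/-- `1 ⊗ X_a` is a vector operator on `[N] ⊗ [ν]`. -/
theorem tensorGen_isVectorOperator_right (n l : ℕ) :
    IsVectorOperator (tensorGen n l) (fun a => (1 : A n) ⊗ₖ X l a) := by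
  have h := right_isVectorOperator n l
  have e : ∀ a b, tensorGen n l a * ((1 : A n) ⊗ₖ X l b) - ((1 : A n) ⊗ₖ X l b) * tensorGen n l a =
      ((1 : A n) ⊗ₖ X l a) * ((1 : A n) ⊗ₖ X l b) - ((1 : A n) ⊗ₖ X l b) *
          ((1 : A n) ⊗ₖ X l a) := by
    intro a b
    rw [tensorGen, add_mul, mul_add, kronecker_one_commute]
    abel
  exact ⟨fun a => (e _ _).trans (h.comm_self a), fun a => (e _ _).trans (h.comm_add_one a),
    fun a => (e _ _).trans (h.comm_add_two a)⟩

theorem tensorGen_isSpinRep (n l : ℕ) : IsSpinRep (tensorGen n l) := by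
  have h := right_isVectorOperator n l
  have h' := left_isVectorOperator n l
  refine ⟨isVectorOperator_of_comm fun a => ?_, fun a => ?_⟩
  · have e : tensorGen n l a * tensorGen n l (a + 1) - tensorGen n l (a + 1) * tensorGen n l a =
        ((X n a ⊗ₖ (1 : A l)) * (X n (a + 1) ⊗ₖ (1 : A l)) -
          (X n (a + 1) ⊗ₖ (1 : A l)) * (X n a ⊗ₖ (1 : A l))) +
        (((1 : A n) ⊗ₖ X l a) * ((1 : A n) ⊗ₖ X l (a + 1)) -
          ((1 : A n) ⊗ₖ X l (a + 1)) * ((1 : A n) ⊗ₖ X l a)) := by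
      rw [tensorGen, tensorGen, add_mul, add_mul, mul_add, mul_add, mul_add, mul_add,
        kronecker_one_commute, kronecker_one_commute]
      abel
    rw [e, h.comm_add_one, h'.comm_add_one, ← smul_add, tensorGen]
  · rw [tensorGen, conjTranspose_add, conjTranspose_kronecker, conjTranspose_kronecker, X_herm,
      X_herm, conjTranspose_one, conjTranspose_one]

theorem tensorGen_casimir (n l : ℕ) :
    tensorGen n l 0 * tensorGen n l 0 + tensorGen n l 1 * tensorGen n l 1 +
      tensorGen n l 2 * tensorGen n l 2 =
    ((n : ℂ) / 2 * (n / 2 + 1) + (l : ℂ) / 2 * (l / 2 + 1)) • 1 +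
      (2 : ℂ) • ∑ a, (X n a ⊗ₖ (1 : A l)) * ((1 : A n) ⊗ₖ X l a) := by
  have e : ∀ a, tensorGen n l a * tensorGen n l a = (X n a * X n a) ⊗ₖ (1 : A l) +
      (1 : A n) ⊗ₖ (X l a * X l a) + (2 : ℂ) • ((X n a ⊗ₖ (1 : A l)) * ((1 : A n) ⊗ₖ X l a)) := by
    intro a
    rw [tensorGen, add_mul, mul_add, mul_add, ← kronecker_one_commute, two_smul,
      ← mul_kronecker_mul, ← mul_kronecker_mul, ← mul_kronecker_mul, Matrix.one_mul, Matrix.one_mul,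
      Matrix.mul_one, Matrix.mul_one]
    abel
  have h1 := congrArg (fun B => B ⊗ₖ (1 : A l)) (X_casimir n)
  have h2 := congrArg (fun B => (1 : A n) ⊗ₖ B) (X_casimir l)
  simp only [add_kronecker, kronecker_add, smul_kronecker, kronecker_smul,
      one_kronecker_one] at h1 h2
  rw [Fin.sum_univ_three, add_smul, ← h1, ← h2, e, e, e]
  module

/-- The extension by zero of a vector to `ℕ × ℕ`. -/
noncomputable def extend {n l : ℕ} (u : Fin (n + 1) × Fin (l + 1) → ℂ) (r i : ℕ) : ℂ :=
  if h : r < n + 1 ∧ i < l + 1 then u (⟨r, h.1⟩, ⟨i, h.2⟩) else 0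

/-! ### Highest weight vectors of [N] ⊗ [ν] in coordinates -/

/-- Letting f be defined on ℕ removes the boundary case: at i = n the coefficient `ladder n n` is
zero, so the value f (n + 1) does not matter. -/
theorem Xplus_mulVec_apply {n : ℕ} (f : ℕ → ℂ) (i : Fin (n + 1)) :
    ∑ j : Fin (n + 1), Xplus n i j * f j = ladder n i * f (i + 1) := by
  by_cases hi : (i : ℕ) + 1 < n + 1
  · rw [Finset.sum_eq_single ⟨i + 1, hi⟩]
    · simp [Xplus_apply]
    · intro b _ hb
      rw [Xplus_apply, if_neg, zero_mul]
      exact fun h' => hb (Fin.ext h'.symm)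
    · simp
  · have hin : (i : ℕ) = n := by omega
    rw [Finset.sum_eq_zero fun j _ => by rw [Xplus_apply, if_neg (by omega), zero_mul], hin,
      ladder_self]
    simp

theorem raising_tensorGen (n l : ℕ) :
    raising (tensorGen n l) = Xplus n ⊗ₖ (1 : A l) + (1 : A n) ⊗ₖ Xplus l := by
  rw [raising, tensorGen, tensorGen, ← X_add_I_smul, ← X_add_I_smul, add_kronecker, kronecker_add,
    smul_kronecker, kronecker_smul, smul_add]
  abel

theorem extend_coe {n l : ℕ} (u : Fin (n + 1) × Fin (l + 1) → ℂ) (r : Fin (n + 1))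
    (i : Fin (l + 1)) : extend u r i = u (r, i) := by
  rw [extend, dif_pos ⟨r.2, i.2⟩]

theorem raising_tensorGen_mulVec_apply {n l : ℕ} (u : Fin (n + 1) × Fin (l + 1) → ℂ)
    (r : Fin (n + 1)) (i : Fin (l + 1)) :
    (raising (tensorGen n l) *ᵥ u) (r, i) =
      ladder n r * extend u (r + 1) i + ladder l i * extend u r (i + 1) := by
  rw [raising_tensorGen, add_mulVec, Pi.add_apply]
  congr 1
  · rw [← Xplus_mulVec_apply (fun k => extend u k i), mulVec, dotProduct, Fintype.sum_prod_type]
    refine Finset.sum_congr rfl fun s _ => ?_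
    rw [Finset.sum_eq_single i]
    · simp [extend_coe]
    · intro b _ hb
      simp [one_apply_ne hb.symm]
    · simp
  · rw [← Xplus_mulVec_apply (fun k => extend u r k), mulVec, dotProduct, Fintype.sum_prod_type,
      Finset.sum_eq_single r]
    · simp [extend_coe]
    · intro b _ hb
      simp [one_apply_ne hb.symm]
    · simp

theorem tensorGen_two_mulVec_apply {n l : ℕ} (u : Fin (n + 1) × Fin (l + 1) → ℂ)
    (r : Fin (n + 1)) (i : Fin (l + 1)) :
    (tensorGen n l 2 *ᵥ u) (r, i) =
      ((n : ℂ) / 2 - (r : ℕ) + ((l : ℂ) / 2 - (i : ℕ))) * u (r, i) := by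
  rw [tensorGen, X_two, X_two, ← diagonal_one, ← diagonal_one, diagonal_kronecker_diagonal,
    diagonal_kronecker_diagonal, diagonal_add, mulVec_diagonal]
  simp

/-- The basis vector (r, i) has weight (n + l)/2 - (r + i), so a weight vector is supported on a
single antidiagonal. -/
theorem IsHighestWeight.apply_eq_zero {n l m : ℕ} {u : Fin (n + 1) × Fin (l + 1) → ℂ}
    (h : IsHighestWeight (tensorGen n l) m u) {r : Fin (n + 1)} {i : Fin (l + 1)}
    (hri : m + 2 * ((r : ℕ) + i) ≠ n + l) : u (r, i) = 0 := by
  have := congrFun h.weight (r, i)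
  rw [tensorGen_two_mulVec_apply, Pi.smul_apply, smul_eq_mul, ← sub_eq_zero, ← sub_mul,
    mul_eq_zero] at this
  refine this.resolve_left fun h' => hri ?_
  have : (m : ℂ) + 2 * ((r : ℕ) + (i : ℕ)) = n + l := by linear_combination -2 * h'
  exact_mod_cast this

theorem exists_isHighestWeight_add (n l : ℕ) :
    ∃ u, u ≠ 0 ∧ IsHighestWeight (tensorGen n l) (n + l) u := by
  refine ⟨Pi.single (0, 0) 1, by simp, ?_, ?_⟩
  · ext ⟨r, i⟩
    rw [raising_tensorGen_mulVec_apply]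
    simp [extend]
  · ext ⟨r, i⟩
    rw [tensorGen_two_mulVec_apply, Pi.smul_apply, smul_eq_mul, Pi.single_apply]
    split_ifs with h
    · obtain ⟨rfl, rfl⟩ := Prod.mk.inj h
      push_cast
      simp
      ring
    · simp

/-- The coefficients of the highest weight vector of `[N - ν]`. -/
noncomputable def antiCoeff (n l : ℕ) : ℕ → ℂ
  | 0 => 1
  | k + 1 => -(ladder l (l - 1 - k) / ladder n k) * antiCoeff n l k

theorem exists_isHighestWeight_sub {n l : ℕ} (hl : l < n) :
    ∃ u, u ≠ 0 ∧ IsHighestWeight (tensorGen n l) (n - l) u := by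
  set u : Fin (n + 1) × Fin (l + 1) → ℂ := fun x =>
    if (x.1 : ℕ) + x.2 = l then antiCoeff n l x.1 else 0 with hu
  have he : ∀ r i, extend u r i = if r + i = l then antiCoeff n l r else 0 := by
    intro r i
    simp only [extend, hu]
    split_ifs with h1 h2 h2 <;> first | rfl | omega
  refine ⟨u, ?_, ?_, ?_⟩
  · intro h0
    have := congrFun h0 (0, Fin.last l)
    simp [hu, antiCoeff] at this
  · ext ⟨⟨r, hr⟩, ⟨i, hi⟩⟩
    rw [raising_tensorGen_mulVec_apply, he, he]
    simp only [Pi.zero_apply]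
    by_cases h : r + i + 1 = l
    -- Here i = l - 1 - r, and the vanishing of M₊u at (r, i) is exactly the recursion defining
    -- `antiCoeff`.
    · rw [if_pos (by omega), if_pos (by omega), antiCoeff, show l - 1 - r = i by omega]
      have := ladder_ne_zero (show r < n by omega)
      field_simp
      ring
    · rw [if_neg (by omega), if_neg (by omega)]
      simp
  · ext ⟨r, i⟩
    rw [tensorGen_two_mulVec_apply, Pi.smul_apply, smul_eq_mul]
    simp only [hu]
    split_ifs with h
    · congr 1
      have : (l : ℂ) = (r : ℕ) + (i : ℕ) := by exact_mod_cast h.symm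
      rw [Nat.cast_sub hl.le, this]
      ring
    · simp

theorem IsHighestWeight.eq_zero_of_add {n l : ℕ} {u : Fin (n + 1) × Fin (l + 1) → ℂ}
    (h : IsHighestWeight (tensorGen n l) (n + l) u) (h0 : u (0, 0) = 0) : u = 0 := by
  ext ⟨r, i⟩
  by_cases hri : (r : ℕ) + i = 0
  · have hr : r = 0 := Fin.ext (by rw [Fin.val_zero]; omega)
    have hi : i = 0 := Fin.ext (by rw [Fin.val_zero]; omega)
    rw [hr, hi, h0, Pi.zero_apply]
  · exact h.apply_eq_zero (by omega)

/-- On the antidiagonal k + i = l, the equation M₊u = 0 determines the entry at k + 1 from the one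
at k; l < n keeps the ladder coefficients that are divided out nonzero. -/
theorem IsHighestWeight.eq_zero_of_sub {n l : ℕ} (hl : l < n)
    {u : Fin (n + 1) × Fin (l + 1) → ℂ} (h : IsHighestWeight (tensorGen n l) (n - l) u)
    (h0 : u (0, Fin.last l) = 0) : u = 0 := by
  have key : ∀ k i, k + i = l → extend u k i = 0 := by
    intro k
    induction k with
    | zero =>
      intro i hi
      obtain rfl : i = l := by omega
      exact (extend_coe u 0 (Fin.last i)).trans h0
    | succ k ih =>
      intro i hi
      have := congrFun h.raise (⟨k, by omega⟩, ⟨i, by omega⟩)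
      rw [raising_tensorGen_mulVec_apply] at this
      simp only [ih (i + 1) (by omega), mul_zero, add_zero, Pi.zero_apply, mul_eq_zero] at this
      exact this.resolve_left (ladder_ne_zero (by omega))
  ext ⟨r, i⟩
  by_cases hri : (r : ℕ) + i = l
  · rw [← extend_coe u, key _ _ hri, Pi.zero_apply]
  · exact h.apply_eq_zero (by omega)

/-! ### Subrepresentations of `[N] ⊗ [ν]` -/

/-- A submodule of the Hilbert space `[N] ⊗ [ν]` as a submodule of the space of coordinate
functions. -/
noncomputable def coordSubmodule {n l : ℕ} :
    Submodule ℂ (TensorSpace n l) ≃o Submodule ℂ (Fin (n + 1) × Fin (l + 1) → ℂ) :=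
  Submodule.orderIsoMapComap (WithLp.linearEquiv 2 ℂ (Fin (n + 1) × Fin (l + 1) → ℂ))

theorem ofLp_mem_coordSubmodule {n l : ℕ} {K : Submodule ℂ (TensorSpace n l)}
    {x : TensorSpace n l} : x.ofLp ∈ coordSubmodule K ↔ x ∈ K := by
  change (WithLp.linearEquiv 2 ℂ (Fin (n + 1) × Fin (l + 1) → ℂ)) x ∈ Submodule.map _ K ↔ _
  simp

theorem isSubrep_iff {n l : ℕ} {K : Submodule ℂ (TensorSpace n l)} :
    IsSubrep K ↔ IsInvariant (tensorGen n l) (coordSubmodule K) := by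
  constructor
  · intro h a x hx
    exact ofLp_mem_coordSubmodule.2 (h a (WithLp.toLp 2 x) (ofLp_mem_coordSubmodule.1 hx))
  · intro h a x hx
    exact ofLp_mem_coordSubmodule.1 (h a x.ofLp (ofLp_mem_coordSubmodule.2 hx))

theorem finrank_coordSubmodule {n l : ℕ} (K : Submodule ℂ (TensorSpace n l)) :
    Module.finrank ℂ (coordSubmodule K) = Module.finrank ℂ K :=
  LinearEquiv.finrank_map_eq (WithLp.linearEquiv 2 ℂ (Fin (n + 1) × Fin (l + 1) → ℂ)) K

/-- A highest weight vector in K generates an invariant subspace, which is all of K by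
irreducibility; comparing dimensions identifies its weight as m/2. -/
theorem IsSpinSubrep.exists_intertwiner {n l m : ℕ} {K : Submodule ℂ (TensorSpace n l)}
    (hK : IsSpinSubrep m K) :
    ∃ u, star u ⬝ᵥ u = 1 ∧ IsHighestWeight (tensorGen n l) m u ∧
      coordSubmodule K = LinearMap.range (intertwiner (tensorGen n l) m u).mulVecLin := by
  have hM := tensorGen_isSpinRep n l
  have hinv := isSubrep_iff.1 hK.invariant
  obtain ⟨m', u, huK, hu1, hu⟩ := hinv.exists_isHighestWeight hM
    (fun h => hK.ne_bot (by simpa using h))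
  have hle := hinv.range_intertwiner_le huK m'
  set W := LinearMap.range (intertwiner (tensorGen n l) m' u).mulVecLin with hW
  have hfin : Module.finrank ℂ W = m' + 1 := hu.finrank_range hM hu1
  have heq : W = coordSubmodule K := by
    rcases hK.irreducible (coordSubmodule.symm W)
      (isSubrep_iff.2 (by rw [OrderIso.apply_symm_apply]; exact hu.isInvariant_range hM))
      (by rwa [OrderIso.symm_apply_le]) with h | h
    · rw [OrderIso.symm_apply_eq, OrderIso.map_bot] at h
      rw [h, finrank_bot] at hfin
      omega
    · rw [← h, OrderIso.apply_symm_apply]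
  have : m' = m := by
    have := hK.finrank_eq
    rw [← finrank_coordSubmodule, ← heq, hfin] at this
    omega
  subst this
  exact ⟨u, hu1, hu, heq.symm⟩

theorem existsUnique_isSpinSubrep {n l m : ℕ} {x : Fin (n + 1) × Fin (l + 1)}
    (hex : ∃ u, u ≠ 0 ∧ IsHighestWeight (tensorGen n l) m u)
    (huniq : ∀ u, IsHighestWeight (tensorGen n l) m u → u x = 0 → u = 0) :
    ∃! K : Submodule ℂ (TensorSpace n l), IsSpinSubrep m K := by
  have hM := tensorGen_isSpinRep n l
  obtain ⟨u₀, hu₀, h₀⟩ := hex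
  obtain ⟨c, hc⟩ := exists_normalized hu₀
  have hu := h₀.smul c
  set u := c • u₀
  set W := LinearMap.range (intertwiner (tensorGen n l) m u).mulVecLin with hW
  have hfin : Module.finrank ℂ W = m + 1 := hu.finrank_range hM hc
  refine ⟨coordSubmodule.symm W, ⟨?_, ?_, ?_, ?_⟩, ?_⟩
  · rw [isSubrep_iff, OrderIso.apply_symm_apply]
    exact hu.isInvariant_range hM
  · intro h
    rw [OrderIso.symm_apply_eq, OrderIso.map_bot] at h
    rw [h, finrank_bot] at hfin
    omega
  · intro K' hK' hle
    rw [or_iff_not_imp_left]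
    intro h0
    rw [OrderIso.eq_symm_apply]
    exact hu.irreducible hM hc (isSubrep_iff.1 hK') (fun h => h0 (by simpa using h))
      ((OrderIso.le_symm_apply _).1 hle)
  · rw [← finrank_coordSubmodule, OrderIso.apply_symm_apply, hfin]
  · intro K hK
    obtain ⟨v, hv1, hv, hKv⟩ := hK.exists_intertwiner
    rw [OrderIso.eq_symm_apply, hKv]
    have hv0 : v x ≠ 0 := fun h => by
      rw [huniq v hv h] at hv1
      simp at hv1
    -- The difference is again a highest weight vector of the same weight, and its x-coordinate
    -- vanishes.
    have huv : u = (u x / v x) • v := by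
      rw [← sub_eq_zero]
      refine huniq _ (hu.sub (hv.smul _)) ?_
      simp [hv0]
    have hmem : u ∈ LinearMap.range (intertwiner (tensorGen n l) m v).mulVecLin := by
      rw [huv]
      exact Submodule.smul_mem _ _ (self_mem_range_intertwiner m v)
    have hle := (hv.isInvariant_range hM).range_intertwiner_le hmem m
    refine (hv.irreducible hM hv1 (hu.isInvariant_range hM) (fun h => ?_) hle).symm
    rw [← hW] at h
    rw [h, finrank_bot] at hfin
    omega

/-- The orthogonal projection onto the range of an isometry `T` is `T Tᴴ`. -/
theorem starProjection_eq {n l m : ℕ} {K : Submodule ℂ (TensorSpace n l)}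
    {T : Matrix (Fin (n + 1) × Fin (l + 1)) (Fin (m + 1)) ℂ} (hT : Tᴴ * T = 1)
    (hK : coordSubmodule K = LinearMap.range T.mulVecLin) :
    (Matrix.toEuclideanCLM (n := Fin (n + 1) × Fin (l + 1)) (𝕜 := ℂ)).symm K.starProjection =
      T * Tᴴ := by
  rw [StarAlgEquiv.symm_apply_eq]
  ext1 x
  refine Submodule.eq_starProjection_of_mem_of_inner_eq_zero ?_ ?_
  · rw [← ofLp_mem_coordSubmodule, hK, ofLp_toEuclideanCLM]
    exact ⟨Tᴴ *ᵥ x.ofLp, by simp⟩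
  · intro w hw
    rw [← ofLp_mem_coordSubmodule, hK] at hw
    obtain ⟨y, hy⟩ := hw
    rw [EuclideanSpace.inner_eq_star_dotProduct, WithLp.ofLp_sub, ofLp_toEuclideanCLM, ← hy,
      star_sub, dotProduct_sub, sub_eq_zero, star_mulVec, dotProduct_comm _ (_ ᵥ* _),
      ← dotProduct_mulVec, dotProduct_comm, mulVecLin_apply, conjTranspose_mul,
      conjTranspose_conjTranspose, mulVec_mulVec, Matrix.mul_assoc, hT, Matrix.mul_one]

/-! ### Two-forms -/

/-- The derivation `e_a` as an element of `Der₃`. -/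
noncomputable def der (n : ℕ) (a : Fin 3) : Der3 n :=
  ⟨e n a, Submodule.subset_span ⟨a, rfl⟩⟩

theorem d_der {n : ℕ} (φ : A n) (a : Fin 3) : d φ (der n a) = X n a * φ - φ * X n a := rfl

theorem TwoForm.eq_zero_of_der_left {n : ℕ} {ω : TwoForm n} {v : Der3 n}
    (h : ∀ a, ω ![der n a, v] = 0) (u : Der3 n) : ω ![u, v] = 0 := by
  obtain ⟨x, hx⟩ := u
  induction hx using Submodule.span_induction with
  | mem x hx =>
    obtain ⟨a, rfl⟩ := hx
    exact h a
  | zero => exact ω.map_coord_zero 0 rfl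
  | add x y hx hy ihx ihy =>
    have := ω.map_vecCons_add ![v] ⟨x, hx⟩ ⟨y, hy⟩
    rw [ihx, ihy, add_zero] at this
    exact this
  | smul c x hx ih =>
    have := ω.map_vecCons_smul ![v] c ⟨x, hx⟩
    rw [ih, smul_zero] at this
    exact this

theorem TwoForm.swap {n : ℕ} (ω : TwoForm n) (u v : Der3 n) : ω ![u, v] = -ω ![v, u] := by
  have := ω.map_swap ![v, u] (show (0 : Fin 2) ≠ 1 by decide)
  rw [← this]
  congr 1
  ext i
  fin_cases i <;> rfl

/-- The e_a span Der₃ and the forms are alternating, so the three cyclic pairs suffice. Linear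
independence of the e_a is not needed. -/
theorem TwoForm.ext_der {n : ℕ} {ω ω' : TwoForm n}
    (h : ∀ a, ω ![der n a, der n (a + 1)] = ω' ![der n a, der n (a + 1)]) : ω = ω' := by
  rw [← sub_eq_zero]
  set δ := ω - ω' with hδ
  have h1 : ∀ a, δ ![der n a, der n (a + 1)] = 0 := fun a => by
    rw [hδ, AlternatingMap.sub_apply, h, sub_self]
  have h2 : ∀ a b, δ ![der n a, der n b] = 0 := by
    intro a b
    have hab : b = a ∨ b = a + 1 ∨ a = b + 1 := by
      revert a b
      decide
    rcases hab with rfl | rfl | rfl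
    · exact δ.map_eq_zero_of_eq _ (i := 0) (j := 1) rfl (by decide)
    · exact h1 a
    · rw [TwoForm.swap, h1, neg_zero]
  have h3 : ∀ u b, δ ![u, der n b] = 0 := fun u b => TwoForm.eq_zero_of_der_left (fun a => h2 a b) u
  ext1 v
  have : v = ![v 0, v 1] := by
    ext i
    fin_cases i <;> rfl
  rw [this]
  exact TwoForm.eq_zero_of_der_left (fun a => by rw [TwoForm.swap, h3, neg_zero]) _

theorem wedge_apply {n : ℕ} (α β : OneForm n) (u v : Der3 n) :
    wedge α β ![u, v] = α u * β v - α v * β u := rfl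

theorem lmul_apply {n : ℕ} (φ : A n) (ω : TwoForm n) (v : Fin 2 → Der3 n) :
    lmul φ ω v = φ * ω v := rfl

theorem TwoForm.sum_apply {n : ℕ} {κ : Type*} (s : Finset κ) (f : κ → TwoForm n)
    (v : Fin 2 → Der3 n) : (∑ i ∈ s, f i) v = ∑ i ∈ s, f i v := by
  classical
  induction s using Finset.induction_on with
  | empty => simp
  | insert a s ha ih => rw [Finset.sum_insert ha, Finset.sum_insert ha, ← ih]; rfl

theorem sum_eps_smul {V : Type*} [AddCommGroup V] [Module ℂ V] (F : Fin 3 → Fin 3 → Fin 3 → V) :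
    ∑ i, ∑ j, ∑ k, eps i j k • F i j k =
      F 0 1 2 - F 0 2 1 + (F 1 2 0 - F 1 0 2) + (F 2 0 1 - F 2 1 0) := by
  have h : ∀ i j k, eps i j k = (((((j : ℕ) : ℤ) - ((i : ℕ) : ℤ)) *
      (((k : ℕ) : ℤ) - ((i : ℕ) : ℤ)) *
    (((k : ℕ) : ℤ) - ((j : ℕ) : ℤ)) / 2 : ℤ) : ℂ) := by
    intro i j k
    fin_cases i <;> fin_cases j <;> fin_cases k <;> norm_num [eps]
  simp only [Fin.sum_univ_three, h]
  norm_num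
  module

/-- `ε_{cde} X_c [X_a, X_d] [X_{a+1}, X_e]`, antisymmetrized, is a multiple of `X_{a+2}`. -/
theorem cyclic_sum_eq {R : Type*} [Ring R] [Algebra ℂ R] {A B C : R} {c : ℂ}
    (hBA : B * A = A * B - I • C) (hCB : C * B = B * C - I • A) (hCA : C * A = A * C + I • B)
    (hc : A * A + B * B + C * C = c • 1) :
    A * (C * A) + A * (A * C) + B * (B * C) + B * (C * B) + C * (C * C) + C * (C * C) =
      (2 * c - 1) • C := by
  -- Moving C to the right turns A C A and B C B into A²C and B²C, at the cost of i(AB - BA); that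
  -- commutator, being iC, accounts for the -1 in 2c - 1.
  have h1 : A * (C * A) + A * (A * C) + B * (B * C) + B * (C * B) + C * (C * C) + C * (C * C) =
      (2 : ℂ) • ((A * A + B * B + C * C) * C) + I • (A * B - B * A) := by
    rw [hCA, hCB]
    simp only [mul_add, mul_sub, add_mul, mul_smul_comm, mul_assoc]
    module
  rw [h1, hc, hBA, sub_sub_cancel, smul_smul, I_mul_I, smul_mul_assoc, one_mul]
  module

/-- Each dY contributes a commutator, that is, another generator. The surviving terms form the sum
in `cyclic_sum_eq`, up to sign; the three values of a differ by a cyclic relabelling. -/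
theorem epsYdYdY_apply (n : ℕ) (a : Fin 3) :
    epsYdYdY n ![der n a, der n (a + 1)] =
      ((((spin n * (spin n + 1)) ^ (-(1 / 2) : ℝ) : ℝ) : ℂ) ^ 3 *
        (1 - 2 * ((n : ℂ) / 2 * (n / 2 + 1)))) • X n (a + 2) := by
  have hX := (X_isSpinRep n).vector
  have c01 : X n 0 * X n 1 - X n 1 * X n 0 = I • X n 2 := hX.comm_add_one 0
  have c12 : X n 1 * X n 2 - X n 2 * X n 1 = I • X n 0 := hX.comm_add_one 1
  have c20 : X n 2 * X n 0 - X n 0 * X n 2 = I • X n 1 := hX.comm_add_one 2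
  have c10 : X n 1 * X n 0 - X n 0 * X n 1 = -(I • X n 2) := hX.comm_add_two 0
  have c21 : X n 2 * X n 1 - X n 1 * X n 2 = -(I • X n 0) := hX.comm_add_two 1
  have c02 : X n 0 * X n 2 - X n 2 * X n 0 = -(I • X n 1) := hX.comm_add_two 2
  have hcas := X_casimir n
  set y : ℂ := (((spin n * (spin n + 1)) ^ (-(1 / 2) : ℝ) : ℝ) : ℂ) with hy
  set c : ℂ := (n : ℂ) / 2 * (n / 2 + 1)
  have hdY : ∀ b k, d (Y n k) (der n b) = y • (X n b * X n k - X n k * X n b) := by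
    intro b k
    rw [d_der, Y, mul_smul_comm, smul_mul_assoc, ← smul_sub]
  have hY : ∀ k, Y n k = y • X n k := fun k => rfl
  have expand : ∀ a, epsYdYdY n ![der n a, der n (a + 1)] =
      y ^ 3 • ∑ i, ∑ j, ∑ k, eps i j k • (X n i *
        ((X n a * X n j - X n j * X n a) * (X n (a + 1) * X n k - X n k * X n (a + 1)) -
         (X n (a + 1) * X n j - X n j * X n (a + 1)) * (X n a * X n k - X n k * X n a))) := by
    intro a
    simp only [epsYdYdY, TwoForm.sum_apply, AlternatingMap.smul_apply, lmul_apply,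
      wedge_apply, hdY, Finset.smul_sum]
    refine Finset.sum_congr rfl fun i _ => Finset.sum_congr rfl fun j _ =>
      Finset.sum_congr rfl fun k _ => ?_
    rw [hY, smul_mul_smul_comm, smul_mul_smul_comm, ← smul_sub, smul_mul_smul_comm, smul_comm]
    congr 1
    ring
  have c01' : X n 1 * X n 0 = X n 0 * X n 1 - I • X n 2 := by rw [← c01]; abel
  have c12' : X n 2 * X n 1 = X n 1 * X n 2 - I • X n 0 := by rw [← c12]; abel
  have c20' : X n 0 * X n 2 = X n 2 * X n 0 - I • X n 1 := by rw [← c20]; abel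
  rw [expand, mul_smul, sum_eps_smul, show (1 - 2 * c) = -(2 * c - 1) by ring, neg_smul]
  congr 1
  fin_cases a
  · simp only [Fin.zero_eta, zero_add, ← cyclic_sum_eq c01' c12' (sub_eq_iff_eq_add'.1 c20) hcas]
    simp only [c01, c10, c12, c02, sub_self, mul_zero, zero_mul, neg_mul, mul_neg,
      mul_smul_comm, smul_mul_assoc, smul_smul, I_mul_I, smul_zero, neg_zero, smul_neg, sub_zero,
          zero_sub, neg_neg,
      neg_smul, one_smul]
    abel
  · have hcas' : X n 1 * X n 1 + X n 2 * X n 2 + X n 0 * X n 0 = c • 1 := by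
      rw [← hcas]
      abel
    simp only [Fin.mk_one, show (1 : Fin 3) + 1 = 2 from rfl, show (1 : Fin 3) + 2 = 0 from rfl,
      ← cyclic_sum_eq c12' c20' (sub_eq_iff_eq_add'.1 c01) hcas']
    simp only [c10, c12, c21, c20, sub_self, mul_zero, zero_mul, neg_mul, mul_neg,
      mul_smul_comm, smul_mul_assoc, smul_smul, I_mul_I, smul_zero, neg_zero, smul_neg, sub_zero,
          zero_sub, neg_neg,
      neg_smul, one_smul]
    abel
  · have hcas' : X n 2 * X n 2 + X n 0 * X n 0 + X n 1 * X n 1 = c • 1 := by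
      rw [← hcas]
      abel
    simp only [Fin.reduceFinMk, show (2 : Fin 3) + 1 = 0 from rfl,
      show (2 : Fin 3) + 2 = 1 from rfl,
      ← cyclic_sum_eq c20' c01' (sub_eq_iff_eq_add'.1 c12) hcas']
    simp only [c01, c21, c02, c20, sub_self, mul_zero, zero_mul, neg_mul, mul_neg,
      mul_smul_comm, smul_mul_assoc, smul_smul, I_mul_I, smul_zero, neg_zero, smul_neg, sub_zero,
          zero_sub, neg_neg,
      neg_smul, one_smul]
    abel

/-! ### The partial trace -/

/-- The partial trace over the second factor `[ν]`. -/
noncomputable def partialTrace {n l : ℕ} :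
    Matrix (Fin (n + 1) × Fin (l + 1)) (Fin (n + 1) × Fin (l + 1)) ℂ →ₗ[ℂ] A n where
  toFun B := Matrix.of fun r s => ∑ i, B (r, i) (s, i)
  map_add' B C := by
    ext r s
    simp [Finset.sum_add_distrib]
  map_smul' c B := by
    ext r s
    simp [Finset.mul_sum]

theorem partialTrace_apply {n l : ℕ}
    (B : Matrix (Fin (n + 1) × Fin (l + 1)) (Fin (n + 1) × Fin (l + 1)) ℂ) (r s : Fin (n + 1)) :
    partialTrace B r s = ∑ i, B (r, i) (s, i) := rfl

theorem trace_partialTrace {n l : ℕ}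
    (B : Matrix (Fin (n + 1) × Fin (l + 1)) (Fin (n + 1) × Fin (l + 1)) ℂ) :
    (partialTrace B).trace = B.trace := by
  simp [Matrix.trace, partialTrace_apply, Fintype.sum_prod_type]

theorem kronecker_one_mul_apply {n l : ℕ} (C : A n)
    (B : Matrix (Fin (n + 1) × Fin (l + 1)) (Fin (n + 1) × Fin (l + 1)) ℂ) (r s : Fin (n + 1))
    (i j : Fin (l + 1)) :
    ((C ⊗ₖ (1 : A l)) * B) (r, i) (s, j) = ∑ t, C r t * B (t, i) (s, j) := by
  rw [Matrix.mul_apply, Fintype.sum_prod_type]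
  refine Finset.sum_congr rfl fun t _ => ?_
  simp [Matrix.one_apply]

theorem mul_kronecker_one_apply {n l : ℕ} (C : A n)
    (B : Matrix (Fin (n + 1) × Fin (l + 1)) (Fin (n + 1) × Fin (l + 1)) ℂ) (r s : Fin (n + 1))
    (i j : Fin (l + 1)) :
    (B * (C ⊗ₖ (1 : A l))) (r, i) (s, j) = ∑ t, B (r, i) (t, j) * C t s := by
  rw [Matrix.mul_apply, Fintype.sum_prod_type]
  refine Finset.sum_congr rfl fun t _ => ?_
  simp [Matrix.one_apply]

theorem partialTrace_kronecker_one_mul {n l : ℕ} (C : A n)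
    (B : Matrix (Fin (n + 1) × Fin (l + 1)) (Fin (n + 1) × Fin (l + 1)) ℂ) :
    partialTrace ((C ⊗ₖ (1 : A l)) * B) = C * partialTrace B := by
  ext r s
  simp only [partialTrace_apply, kronecker_one_mul_apply]
  simp only [Matrix.mul_apply, partialTrace_apply, Finset.mul_sum]
  exact Finset.sum_comm

theorem partialTrace_mul_kronecker_one {n l : ℕ} (C : A n)
    (B : Matrix (Fin (n + 1) × Fin (l + 1)) (Fin (n + 1) × Fin (l + 1)) ℂ) :
    partialTrace (B * (C ⊗ₖ (1 : A l))) = partialTrace B * C := by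
  ext r s
  simp only [partialTrace_apply, mul_kronecker_one_apply]
  simp only [Matrix.mul_apply, partialTrace_apply, Finset.sum_mul]
  exact Finset.sum_comm

/-- The partial trace is cyclic with respect to operators on the factor that is traced out. -/
theorem partialTrace_one_kronecker_mul {n l : ℕ} (C : A l)
    (B : Matrix (Fin (n + 1) × Fin (l + 1)) (Fin (n + 1) × Fin (l + 1)) ℂ) :
    partialTrace (((1 : A n) ⊗ₖ C) * B) = partialTrace (B * ((1 : A n) ⊗ₖ C)) := by
  ext r s
  simp only [partialTrace_apply, Matrix.mul_apply, Fintype.sum_prod_type]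
  have h1 : ∀ i, ∑ t : Fin (n + 1), ∑ k : Fin (l + 1), ((1 : A n) ⊗ₖ C) (r, i) (t, k) *
      B (t, k) (s, i) =
      ∑ k, C i k * B (r, k) (s, i) := fun i => by
    rw [Finset.sum_eq_single r]
    · simp
    · intro b _ hb
      simp [one_apply_ne hb.symm]
    · simp
  have h2 : ∀ i, ∑ t : Fin (n + 1), ∑ k : Fin (l + 1), B (r, i) (t, k) *
      ((1 : A n) ⊗ₖ C) (t, k) (s, i) =
      ∑ k, B (r, i) (s, k) * C k i := fun i => by
    rw [Finset.sum_eq_single s]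
    · simp
    · intro b _ hb
      simp [one_apply_ne hb]
    · simp
  simp only [h1, h2]
  rw [Finset.sum_comm]
  exact Finset.sum_congr rfl fun i _ => Finset.sum_congr rfl fun k _ => mul_comm _ _

/-- The 1 ⊗ X_a part of the commutator disappears by cyclicity. Hence the partial trace is
equivariant and sends vector operators to vector operators. -/
theorem partialTrace_comm_tensorGen {n l : ℕ} (a : Fin 3)
    (B : Matrix (Fin (n + 1) × Fin (l + 1)) (Fin (n + 1) × Fin (l + 1)) ℂ) :
    partialTrace (tensorGen n l a * B - B * tensorGen n l a) =
      X n a * partialTrace B - partialTrace B * X n a := by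
  rw [tensorGen, Matrix.add_mul, Matrix.mul_add, map_sub, map_add, map_add,
    partialTrace_kronecker_one_mul, partialTrace_mul_kronecker_one, partialTrace_one_kronecker_mul]
  abel

theorem IsVectorOperator.partialTrace {n l : ℕ}
    {V : Fin 3 → Matrix (Fin (n + 1) × Fin (l + 1)) (Fin (n + 1) × Fin (l + 1)) ℂ}
    (h : IsVectorOperator (tensorGen n l) V) :
    IsVectorOperator (X n) fun a => FuzzySphere.partialTrace (V a) := by
  refine ⟨fun a => ?_, fun a => ?_, fun a => ?_⟩
  · rw [← partialTrace_comm_tensorGen, h.comm_self, map_zero]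
  · rw [← partialTrace_comm_tensorGen, h.comm_add_one, map_smul]
  · rw [← partialTrace_comm_tensorGen, h.comm_add_two, map_neg, map_smul]

/-! ### The Chern character as a partial trace -/

/-- A matrix over `A_N` as an operator on `[N] ⊗ [ν]`. -/
def flatten {n l : ℕ} (p : Matrix (Fin (l + 1)) (Fin (l + 1)) (A n)) :
    Matrix (Fin (n + 1) × Fin (l + 1)) (Fin (n + 1) × Fin (l + 1)) ℂ :=
  Matrix.of fun x y => p x.2 y.2 x.1 y.1

theorem flatten_mul {n l : ℕ} (p q : Matrix (Fin (l + 1)) (Fin (l + 1)) (A n)) :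
    flatten (p * q) = flatten p * flatten q := by
  ext ⟨r, i⟩ ⟨s, j⟩
  simp only [flatten, Matrix.of_apply, Matrix.mul_apply, Matrix.sum_apply, Fintype.sum_prod_type]
  exact Finset.sum_comm

theorem partialTrace_flatten {n l : ℕ} (p : Matrix (Fin (l + 1)) (Fin (l + 1)) (A n)) :
    partialTrace (flatten p) = p.trace := by
  ext r s
  simp [partialTrace_apply, flatten, Matrix.trace, Matrix.sum_apply]

theorem flatten_map_d {n l : ℕ} (p : Matrix (Fin (l + 1)) (Fin (l + 1)) (A n)) (a : Fin 3) :
    flatten (p.map fun φ => d φ (der n a)) =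
      (X n a ⊗ₖ (1 : A l)) * flatten p - flatten p * (X n a ⊗ₖ (1 : A l)) := by
  ext ⟨r, i⟩ ⟨s, j⟩
  rw [Matrix.sub_apply, kronecker_one_mul_apply, mul_kronecker_one_apply]
  rfl

theorem chern_apply {n l : ℕ} (p : Matrix (Fin (l + 1)) (Fin (l + 1)) (A n)) (u v : Der3 n) :
    chern p ![u, v] = (p * p.map (fun φ => d φ u) * p.map fun φ => d φ v).trace -
      (p * p.map (fun φ => d φ v) * p.map fun φ => d φ u).trace := by
  simp only [chern, TwoForm.sum_apply, lmul_apply, wedge_apply, mul_sub, Finset.sum_sub_distrib]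
  have key : ∀ f g : A n → A n, ∑ i, ∑ j, ∑ k, p i j * (f (p j k) * g (p k i)) =
      (p * p.map f * p.map g).trace := by
    intro f g
    simp only [Matrix.trace, Matrix.diag_apply, Matrix.mul_assoc]
    refine Finset.sum_congr rfl fun i _ => ?_
    rw [Matrix.mul_apply]
    refine Finset.sum_congr rfl fun j _ => ?_
    rw [Matrix.mul_apply, Finset.mul_sum]
    rfl
  rw [← key, ← key]

theorem flatten_projector {n l : ℕ} (K : Submodule ℂ (TensorSpace n l)) :
    flatten (projector K) =
      (Matrix.toEuclideanCLM (n := Fin (n + 1) × Fin (l + 1)) (𝕜 := ℂ)).symm K.starProjection :=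
  rfl

theorem chern_apply_der {n l : ℕ} (p : Matrix (Fin (l + 1)) (Fin (l + 1)) (A n)) (a b : Fin 3) :
    chern p ![der n a, der n b] = partialTrace
      (flatten p * ((X n a ⊗ₖ (1 : A l)) * flatten p - flatten p * (X n a ⊗ₖ (1 : A l))) *
          ((X n b ⊗ₖ (1 : A l)) * flatten p - flatten p * (X n b ⊗ₖ (1 : A l))) -
        flatten p * ((X n b ⊗ₖ (1 : A l)) * flatten p - flatten p * (X n b ⊗ₖ (1 : A l))) *
          ((X n a ⊗ₖ (1 : A l)) * flatten p - flatten p * (X n a ⊗ₖ (1 : A l)))) := by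
  rw [chern_apply, map_sub, ← flatten_map_d, ← flatten_map_d, ← flatten_mul, ← flatten_mul,
    ← flatten_mul, ← flatten_mul, partialTrace_flatten, partialTrace_flatten]

/-- If an idempotent `P` commutes with `x + z` and `y + w`, its curvature is expressed in terms of
the compressions of `z` and `w`. -/
theorem curvature_eq {R : Type*} [Ring R] {P x y z w : R} (hP : P * P = P)
    (hx : (x + z) * P = P * (x + z)) (hy : (y + w) * P = P * (y + w)) :
    P * (x * P - P * x) * (y * P - P * y) - P * (y * P - P * y) * (x * P - P * x) =
      (P * z * P) * (P * w * P) - (P * w * P) * (P * z * P) - P * (z * w - w * z) * P := by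
  -- Commutation with x + z removes x altogether, leaving only z and w between copies of P.
  have hx' : x * P - P * x = P * z - z * P := by
    rw [add_mul, mul_add] at hx
    rw [sub_eq_sub_iff_add_eq_add, hx]
    abel
  have hy' : y * P - P * y = P * w - w * P := by
    rw [add_mul, mul_add] at hy
    rw [sub_eq_sub_iff_add_eq_add, hy]
    abel
  have hPl : ∀ t, P * (P * t) = P * t := fun t => by rw [← mul_assoc, hP]
  rw [hx', hy']
  simp only [mul_sub, sub_mul, mul_assoc, hPl]
  abel

/-! ### The Chern character of the line bundles -/

/-- The eigenvalue of the Casimir operator in the spin `n / 2` representation. -/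
noncomputable def casimirValue (n : ℕ) : ℂ := (n : ℂ) / 2 * (n / 2 + 1)

section Intertwiner

variable {n l m : ℕ} {T : Matrix (Fin (n + 1) × Fin (l + 1)) (Fin (m + 1)) ℂ}

theorem conjTranspose_mul_tensorGen (hJ : ∀ a, tensorGen n l a * T = T * X m a) (a : Fin 3) :
    Tᴴ * tensorGen n l a = X m a * Tᴴ := by
  have := congrArg conjTranspose (hJ a)
  rwa [conjTranspose_mul, conjTranspose_mul, (tensorGen_isSpinRep n l).herm, X_herm] at this

/-- The compression of a vector operator by an intertwiner. -/
theorem IsVectorOperator.compress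
    {V : Fin 3 → Matrix (Fin (n + 1) × Fin (l + 1)) (Fin (n + 1) × Fin (l + 1)) ℂ}
    (h : IsVectorOperator (tensorGen n l) V) (hJ : ∀ a, tensorGen n l a * T = T * X m a) :
    IsVectorOperator (X m) fun a => Tᴴ * V a * T := by
  have key : ∀ a b, X m a * (Tᴴ * V b * T) - Tᴴ * V b * T * X m a =
      Tᴴ * (tensorGen n l a * V b - V b * tensorGen n l a) * T := by
    intro a b
    rw [Matrix.mul_assoc (Tᴴ * V b), ← hJ, ← Matrix.mul_assoc (X m a), ← Matrix.mul_assoc (X m a),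
      ← conjTranspose_mul_tensorGen hJ, Matrix.mul_sub, Matrix.sub_mul]
    simp only [Matrix.mul_assoc]
  refine ⟨fun a => ?_, fun a => ?_, fun a => ?_⟩
  · rw [key, h.comm_self, Matrix.mul_zero, Matrix.zero_mul]
  · rw [key, h.comm_add_one, Matrix.mul_smul, Matrix.smul_mul]
  · rw [key, h.comm_add_two, Matrix.mul_neg, Matrix.neg_mul, Matrix.mul_smul, Matrix.smul_mul]

/-- The extension of a vector operator along an intertwiner. -/
theorem IsVectorOperator.expand {V : Fin 3 → A m}
    (h : IsVectorOperator (X m) V) (hJ : ∀ a, tensorGen n l a * T = T * X m a) :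
    IsVectorOperator (tensorGen n l) fun a => T * V a * Tᴴ := by
  have key : ∀ a b, tensorGen n l a * (T * V b * Tᴴ) - T * V b * Tᴴ * tensorGen n l a =
      T * (X m a * V b - V b * X m a) * Tᴴ := by
    intro a b
    rw [Matrix.mul_assoc (T * V b), conjTranspose_mul_tensorGen hJ,
      ← Matrix.mul_assoc (tensorGen n l a), ← Matrix.mul_assoc (tensorGen n l a), hJ,
      Matrix.mul_sub, Matrix.sub_mul]
    simp only [Matrix.mul_assoc]
  refine ⟨fun a => ?_, fun a => ?_, fun a => ?_⟩
  · rw [key, h.comm_self, Matrix.mul_zero, Matrix.zero_mul]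
  · rw [key, h.comm_add_one, Matrix.mul_smul, Matrix.smul_mul]
  · rw [key, h.comm_add_two, Matrix.mul_neg, Matrix.neg_mul, Matrix.mul_smul, Matrix.smul_mul]

/-- The operator is half of J² minus the Casimirs of the two factors, and J² acts on the range of T
by the spin m/2 Casimir. -/
theorem sum_left_mul_right_mul_intertwiner (hJ : ∀ a, tensorGen n l a * T = T * X m a) :
    (∑ a, (X n a ⊗ₖ (1 : A l)) * ((1 : A n) ⊗ₖ X l a)) * T =
      ((casimirValue m - casimirValue n - casimirValue l) / 2) • T := by
  have h2 : ∀ a, tensorGen n l a * tensorGen n l a * T = T * (X m a * X m a) := fun a => by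
    rw [Matrix.mul_assoc, hJ, ← Matrix.mul_assoc, hJ, Matrix.mul_assoc]
  have hC := congrArg (· * T) (tensorGen_casimir n l)
  simp only [Matrix.add_mul, h2, Matrix.smul_mul, Matrix.one_mul] at hC
  rw [← Matrix.mul_add, ← Matrix.mul_add, X_casimir, Matrix.mul_smul, Matrix.mul_one] at hC
  set S := (∑ a, (X n a ⊗ₖ (1 : A l)) * ((1 : A n) ⊗ₖ X l a)) * T
  have : S = (1 / 2 : ℂ) • ((2 : ℂ) • S) := by rw [smul_smul]; norm_num
  rw [this, ← sub_eq_iff_eq_add'.2 hC, ← sub_smul, smul_smul]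
  congr 1
  simp only [casimirValue]
  ring

/-- The compression of `1 ⊗ X_a` to an irreducible subrepresentation. -/
theorem exists_compress_right (hT : Tᴴ * T = 1) (hJ : ∀ a, tensorGen n l a * T = T * X m a) :
    ∃ κ : ℂ, κ * casimirValue m = (casimirValue m + casimirValue l - casimirValue n) / 2 ∧
      ∀ a, Tᴴ * ((1 : A n) ⊗ₖ X l a) * T = κ • X m a := by
  obtain ⟨κ, hκ⟩ := ((tensorGen_isVectorOperator_right n l).compress hJ).exists_eq_smul
  refine ⟨κ, ?_, hκ⟩
  -- The sum of X_a TᴴZ_aT is evaluated twice: from proportionality to X_a, and from J·Z = X·Z + Z²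
  -- on the range of T.
  have h1 : ∑ a, X m a * (Tᴴ * ((1 : A n) ⊗ₖ X l a) * T) = (κ * casimirValue m) • (1 : A m) := by
    simp only [hκ, Matrix.mul_smul]
    rw [← Finset.smul_sum, Fin.sum_univ_three, X_casimir, smul_smul, casimirValue]
  have h2 : ∑ a, tensorGen n l a * ((1 : A n) ⊗ₖ X l a) =
      (∑ a, (X n a ⊗ₖ (1 : A l)) * ((1 : A n) ⊗ₖ X l a)) + casimirValue l • 1 := by
    have hc := congrArg (fun B => (1 : A n) ⊗ₖ B) (X_casimir l)
    simp only [kronecker_add, kronecker_smul, one_kronecker_one] at hc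
    simp only [tensorGen, add_mul, Finset.sum_add_distrib, ← mul_kronecker_mul, Matrix.one_mul]
    rw [casimirValue, ← hc, Fin.sum_univ_three (fun a => (1 : A n) ⊗ₖ (X l a * X l a))]
  have h3 : ∑ a, X m a * (Tᴴ * ((1 : A n) ⊗ₖ X l a) * T) =
      ((casimirValue m + casimirValue l - casimirValue n) / 2) • (1 : A m) := by
    have : ∀ a, X m a * (Tᴴ * ((1 : A n) ⊗ₖ X l a) * T) =
        Tᴴ * (tensorGen n l a * ((1 : A n) ⊗ₖ X l a) * T) := fun a => by
      rw [← Matrix.mul_assoc, ← Matrix.mul_assoc, ← conjTranspose_mul_tensorGen hJ]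
      simp only [Matrix.mul_assoc]
    simp only [this]
    rw [← Matrix.mul_sum, ← Matrix.sum_mul, h2, Matrix.add_mul,
      sum_left_mul_right_mul_intertwiner hJ, Matrix.smul_mul, Matrix.one_mul, ← add_smul,
      Matrix.mul_smul, hT]
    congr 1
    ring
  rw [h1] at h3
  simpa using congrFun (congrFun h3 0) 0

/-- Wigner–Eckart on [N] gives c. Its value follows by contracting with X_a and taking the full
trace, which produces the dimensions n + 1 and m + 1. -/
theorem exists_partialTrace_eq (hT : Tᴴ * T = 1) (hJ : ∀ a, tensorGen n l a * T = T * X m a) :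
    ∃ c : ℂ, c * (casimirValue n * (n + 1)) =
        (casimirValue m + casimirValue n - casimirValue l) / 2 * (m + 1) ∧
      ∀ a, partialTrace (T * X m a * Tᴴ) = c • X n a := by
  obtain ⟨c, hc⟩ := ((X_isSpinRep m).vector.expand hJ).partialTrace.exists_eq_smul
  refine ⟨c, ?_, hc⟩
  have h1 : (∑ a, X n a * partialTrace (T * X m a * Tᴴ)).trace =
      c * (casimirValue n * (n + 1)) := by
    simp only [hc, Matrix.mul_smul]
    rw [← Finset.smul_sum, Fin.sum_univ_three, X_casimir, smul_smul, trace_smul, trace_one,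
      casimirValue, smul_eq_mul, Fintype.card_fin]
    push_cast
    ring
  have h2 : ∑ a, (X n a ⊗ₖ (1 : A l)) * tensorGen n l a =
      casimirValue n • 1 + ∑ a, (X n a ⊗ₖ (1 : A l)) * ((1 : A n) ⊗ₖ X l a) := by
    have hc := congrArg (fun B => B ⊗ₖ (1 : A l)) (X_casimir n)
    simp only [add_kronecker, smul_kronecker, one_kronecker_one] at hc
    simp only [tensorGen, mul_add, Finset.sum_add_distrib]
    rw [casimirValue, ← hc, Fin.sum_univ_three]
    simp only [← mul_kronecker_mul, Matrix.one_mul]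
  have h3 : (∑ a, X n a * partialTrace (T * X m a * Tᴴ)).trace =
      (casimirValue m + casimirValue n - casimirValue l) / 2 * (m + 1) := by
    have : ∀ a, X n a * partialTrace (T * X m a * Tᴴ) =
        partialTrace ((X n a ⊗ₖ (1 : A l)) * tensorGen n l a * T * Tᴴ) := fun a => by
      rw [← partialTrace_kronecker_one_mul, ← hJ]
      simp only [Matrix.mul_assoc]
    simp only [this]
    rw [← map_sum, trace_partialTrace, ← Matrix.sum_mul, ← Matrix.sum_mul, h2, Matrix.add_mul,
      sum_left_mul_right_mul_intertwiner hJ, Matrix.smul_mul, Matrix.one_mul, ← add_smul,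
      Matrix.smul_mul, trace_smul, trace_mul_comm, hT, trace_one, smul_eq_mul, Fintype.card_fin]
    push_cast
    ring
  rw [← h1, h3]

end Intertwiner

/-- In `curvature_eq`, the commutator of the compressions gives iκ² and the compression of [Z_a,
Z_{a+1}] gives iκ, both times T X_{a+2} Tᴴ; the partial trace supplies c. -/
theorem IsSpinSubrep.exists_chern_apply {n l m : ℕ} {K : Submodule ℂ (TensorSpace n l)}
    (hK : IsSpinSubrep m K) :
    ∃ κ c : ℂ, κ * casimirValue m = (casimirValue m + casimirValue l - casimirValue n) / 2 ∧
      c * (casimirValue n * (n + 1)) =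
        (casimirValue m + casimirValue n - casimirValue l) / 2 * (m + 1) ∧
      ∀ a, chern (projector K) ![der n a, der n (a + 1)] =
        (I * (κ ^ 2 - κ) * c) • X n (a + 2) := by
  obtain ⟨u, hu1, hu, hKT⟩ := hK.exists_intertwiner
  have hM := tensorGen_isSpinRep n l
  have hT := hu.conjTranspose_mul_intertwiner hM hu1
  have hJ := hu.mul_intertwiner hM
  set T := intertwiner (tensorGen n l) m u
  obtain ⟨κ, hκ, hκ'⟩ := exists_compress_right hT hJ
  obtain ⟨c, hc, hc'⟩ := exists_partialTrace_eq hT hJ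
  refine ⟨κ, c, hκ, hc, fun a => ?_⟩
  have hTl : ∀ {k : Type} (B : Matrix (Fin (m + 1)) k ℂ), Tᴴ * (T * B) = B := fun B => by
    rw [← Matrix.mul_assoc, hT, Matrix.one_mul]
  have hP : (T * Tᴴ) * (T * Tᴴ) = T * Tᴴ := by rw [Matrix.mul_assoc, hTl]
  have hcomm : ∀ a, (X n a ⊗ₖ (1 : A l) + (1 : A n) ⊗ₖ X l a) * (T * Tᴴ) =
      (T * Tᴴ) * (X n a ⊗ₖ (1 : A l) + (1 : A n) ⊗ₖ X l a) := fun a => by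
    change tensorGen n l a * (T * Tᴴ) = T * Tᴴ * tensorGen n l a
    rw [← Matrix.mul_assoc, hJ, Matrix.mul_assoc T Tᴴ, conjTranspose_mul_tensorGen hJ,
      Matrix.mul_assoc]
  have hPZP : ∀ a, T * Tᴴ * ((1 : A n) ⊗ₖ X l a) * (T * Tᴴ) = κ • (T * X m a * Tᴴ) := fun a => by
    rw [← Matrix.smul_mul, ← Matrix.mul_smul, ← hκ']
    simp only [Matrix.mul_assoc]
  have hmul : ∀ a b, T * X m a * Tᴴ * (T * X m b * Tᴴ) = T * (X m a * X m b) * Tᴴ := fun a b => by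
    simp only [Matrix.mul_assoc, hTl]
  rw [chern_apply_der, flatten_projector, starProjection_eq hT hKT,
    curvature_eq hP (hcomm a) (hcomm (a + 1)), (right_isVectorOperator n l).comm_add_one a,
    mul_smul_comm, smul_mul_assoc, hPZP, hPZP, hPZP, smul_mul_smul_comm, smul_mul_smul_comm,
    hmul, hmul, ← smul_sub, ← Matrix.sub_mul, ← Matrix.mul_sub,
    (X_isSpinRep m).vector.comm_add_one, Matrix.mul_smul, Matrix.smul_mul, smul_smul, smul_smul,
    ← sub_smul, map_smul, hc', smul_smul]
  congr 1
  ring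

/-! ### Comparison with ε Y dY dY and the values of f -/

/-- The prefactor of q is built to cancel the normalization of Y³ and the factor 1 - 2N(N + 1),
leaving 2f as the coefficient of X_{a+2}. -/
theorem IsSpinSubrep.chern_eq {n l m : ℕ} (hn : 0 < n) {K : Submodule ℂ (TensorSpace n l)}
    (hK : IsSpinSubrep m K) {f : ℂ}
    (hf : ∀ κ c : ℂ, κ * casimirValue m = (casimirValue m + casimirValue l - casimirValue n) / 2 →
      c * (casimirValue n * (n + 1)) =
        (casimirValue m + casimirValue n - casimirValue l) / 2 * (m + 1) →
      2 * f = I * (κ ^ 2 - κ) * c) :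
    chern (projector K) = (I * q (spin n) f / 4) • epsYdYdY n := by
  obtain ⟨κ, c, hκ, hc, hF⟩ := hK.exists_chern_apply
  refine TwoForm.ext_der fun a => ?_
  rw [hF, AlternatingMap.smul_apply, epsYdYdY_apply, smul_smul, ← hf κ c hκ hc]
  congr 1
  have hn' : (1 : ℝ) ≤ n := by exact_mod_cast hn
  have hs : (n : ℂ) / 2 * (n / 2 + 1) = ((spin n * (spin n + 1) : ℝ) : ℂ) := by
    simp [spin]
  set s : ℝ := spin n * (spin n + 1) with hsdef
  -- N ≥ 1/2 gives N(N + 1) ≥ 3/4, so the denominator 1/2 - N(N + 1) is nonzero.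
  have hs' : 3 / 4 ≤ s := by
    rw [hsdef, spin]
    nlinarith
  have hpow : (s ^ (3 / 2 : ℝ)) * (s ^ (-(1 / 2) : ℝ)) ^ 3 = 1 := by
    rw [← Real.rpow_natCast, ← Real.rpow_mul (by linarith), ← Real.rpow_add (by linarith)]
    norm_num
  have hpow' : ((s ^ (3 / 2 : ℝ) : ℝ) : ℂ) * ((s ^ (-(1 / 2) : ℝ) : ℝ) : ℂ) ^ 3 = 1 := by
    exact_mod_cast congrArg (fun x : ℝ => (x : ℂ)) hpow
  have hne : (1 / 2 - s : ℂ) ≠ 0 := by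
    have : (1 / 2 - s : ℝ) ≠ 0 := by linarith
    simpa using Complex.ofReal_ne_zero.2 this
  rw [hs, q, ← hsdef]
  push_cast
  set y : ℂ := ((s ^ (-(1 / 2) : ℝ) : ℝ) : ℂ)
  set w : ℂ := ((s ^ (3 / 2 : ℝ) : ℝ) : ℂ)
  have : I * (4 / I * (w / (1 / 2 - s)) * f) / 4 * (y ^ 3 * (1 - 2 * s)) =
      2 * f * (w * y ^ 3) * ((1 / 2 - s) / (1 / 2 - s)) * (I / I) := by ring
  rw [this, hpow', div_self hne, div_self I_ne_zero]
  ring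

/-- Here κ = ν/(N + ν) and c = (N + ν + 1)(2N + 2ν + 1)/((N + 1)(2N + 1)). -/
theorem two_mul_fPlus {n l : ℕ} (hn : 0 < n) {κ c : ℂ}
    (hκ : κ * casimirValue (n + l) =
      (casimirValue (n + l) + casimirValue l - casimirValue n) / 2)
    (hc : c * (casimirValue n * (n + 1)) =
      (casimirValue (n + l) + casimirValue n - casimirValue l) / 2 * ((n + l : ℕ) + 1)) :
    2 * fPlus (spin n) (spin l) = I * (κ ^ 2 - κ) * c := by
  have h0 : (n : ℂ) ≠ 0 := by exact_mod_cast hn.ne'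
  have h1 : (n : ℂ) + 1 ≠ 0 := by exact_mod_cast n.succ_ne_zero
  have h2 : (n : ℂ) + 2 ≠ 0 := by exact_mod_cast (n + 1).succ_ne_zero
  have h3 : (n : ℂ) + l ≠ 0 := by exact_mod_cast (show n + l ≠ 0 by omega)
  have h4 : (n : ℂ) + l + 2 ≠ 0 := by exact_mod_cast (n + l + 1).succ_ne_zero
  simp only [casimirValue, Nat.cast_add] at hκ hc
  have hκ' : κ = l / (n + l) := by
    rw [eq_div_iff h3]
    apply mul_right_cancel₀ h4
    linear_combination 4 * hκ
  have hc' : c = (n + l + 2) * (n + l + 1) / ((n + 2) * (n + 1)) := by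
    rw [eq_div_iff (mul_ne_zero h2 h1)]
    apply mul_left_cancel₀ h0
    linear_combination 4 * hc
  rw [hκ', hc', fPlus, spin, spin]
  push_cast
  have h5 : (n : ℂ) / 2 + l / 2 = (n + l) / 2 := by ring
  have h6 : 2 * ((n : ℂ) / 2) + 1 = n + 1 := by ring
  have h7 : (n : ℂ) / 2 + 1 = (n + 2) / 2 := by ring
  rw [h5, h6, h7]
  field_simp
  ring

/-- Here κ = -ν/(N - ν + 1) and c = (N - ν)(2N - 2ν + 1)/(N(2N + 1)). -/
theorem two_mul_fMinus {n l : ℕ} (hl : l < n) {κ c : ℂ}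
    (hκ : κ * casimirValue (n - l) =
      (casimirValue (n - l) + casimirValue l - casimirValue n) / 2)
    (hc : c * (casimirValue n * (n + 1)) =
      (casimirValue (n - l) + casimirValue n - casimirValue l) / 2 * ((n - l : ℕ) + 1)) :
    2 * fMinus (spin n) (spin l) = I * (κ ^ 2 - κ) * c := by
  -- With k = n - l - 1 the truncated subtraction disappears and every denominator is a positive
  -- natural number.
  obtain ⟨k, rfl⟩ : ∃ k, n = l + (k + 1) := ⟨n - l - 1, by omega⟩
  rw [Nat.add_sub_cancel_left] at hκ hc
  have h0 : (l : ℂ) + (k + 1) ≠ 0 := by exact_mod_cast (l + k).succ_ne_zero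
  have h1 : (l : ℂ) + (k + 1) + 1 ≠ 0 := by exact_mod_cast (l + k + 1).succ_ne_zero
  have h3 : (k : ℂ) + 1 ≠ 0 := by exact_mod_cast k.succ_ne_zero
  have h4 : (k : ℂ) + 3 ≠ 0 := by exact_mod_cast (k + 2).succ_ne_zero
  have h8 : (l : ℂ) + (k + 1) + 2 ≠ 0 := by exact_mod_cast (l + k + 2).succ_ne_zero
  simp only [casimirValue, Nat.cast_add, Nat.cast_one] at hκ hc
  have hκ' : κ = -l / (k + 3) := by
    rw [eq_div_iff h4]
    apply mul_right_cancel₀ h3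
    linear_combination 4 * hκ
  have hc' : c = (k + 1) * (k + 2) / ((l + (k + 1)) * (l + (k + 1) + 1)) := by
    rw [eq_div_iff (mul_ne_zero h0 h1)]
    apply mul_right_cancel₀ h8
    linear_combination 4 * hc
  rw [hκ', hc', fMinus, spin, spin]
  push_cast
  have h5 : ((l : ℂ) + (k + 1)) / 2 - l / 2 = (k + 1) / 2 := by ring
  have h6 : 2 * (((l : ℂ) + (k + 1)) / 2) = l + (k + 1) := by ring
  have h7 : (k + 1 : ℂ) / 2 + 1 = (k + 3) / 2 := by ring
  rw [h5, h6, h7]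
  field_simp
  ring

end FuzzySphere

theorem mainTheorem1 (n l : ℕ) (hn : 0 < n) :
    ((∃! K : Submodule ℂ (FuzzySphere.TensorSpace n l), FuzzySphere.IsSpinSubrep (n + l) K) ∧
      ∀ K : Submodule ℂ (FuzzySphere.TensorSpace n l), FuzzySphere.IsSpinSubrep (n + l) K →
        FuzzySphere.chern (FuzzySphere.projector K) =
          (Complex.I * FuzzySphere.q (FuzzySphere.spin n)
              (FuzzySphere.fPlus (FuzzySphere.spin n) (FuzzySphere.spin l)) / 4) •
            FuzzySphere.epsYdYdY n) ∧
    (l < n →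
      (∃! K : Submodule ℂ (FuzzySphere.TensorSpace n l), FuzzySphere.IsSpinSubrep (n - l) K) ∧
      ∀ K : Submodule ℂ (FuzzySphere.TensorSpace n l), FuzzySphere.IsSpinSubrep (n - l) K →
        FuzzySphere.chern (FuzzySphere.projector K) =
          (Complex.I * FuzzySphere.q (FuzzySphere.spin n)
              (FuzzySphere.fMinus (FuzzySphere.spin n) (FuzzySphere.spin l)) / 4) •
            FuzzySphere.epsYdYdY n) :=
  ⟨⟨FuzzySphere.existsUnique_isSpinSubrep (FuzzySphere.exists_isHighestWeight_add n l)
      fun _ h => h.eq_zero_of_add,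
    fun _ hK => hK.chern_eq hn fun _ _ => FuzzySphere.two_mul_fPlus hn⟩,
  fun hl => ⟨FuzzySphere.existsUnique_isSpinSubrep (FuzzySphere.exists_isHighestWeight_sub hl)
      fun _ h => h.eq_zero_of_sub hl,
    fun _ hK => hK.chern_eq hn fun _ _ => FuzzySphere.two_mul_fMinus hl⟩⟩
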